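/- Let $H$ be a finite group with $H\neq\{1\}$. Call $(G,H')$ a \emph{Frobenius pair} if $G$ is a finite group and $H'$ is a subgroup of $G$, distinct from $\{1\}$ and from $G$, such that $$\Big|\bigcup_{g\in G} gH'g^{-1}\Big| = |G|-\left(\frac{|G|}{|H'|}-1\right).$$ For a field $K$, call a linear representation $\rho:H\to \mathbf{GL}_n(K)$ with $n\geq 1$ \emph{fixed-point-free} if $H$ acts freely on $K^n\setminus\{0\}$, i.e. if $\rho(h)x\neq x$ for every $h\in H\setminus\{1\}$ and every $x\in K^n\setminus\{0\}$. The following properties are equivalent: (1) $H$ is the complement in some Frobenius pair, i.e. there is a Frobenius pair $(G,H')$ with $H'$ isomorphic to $H$; (2) there exist a field $K$ and a fixed-point-free linear representation $\rho:H\to\mathbf{GL}_n(K)$ for some $n\geq 1$; (3) for every field $K$ whose characteristic does not divide $|H|$, there exists a fixed-point-free linear representation $\rho:H\to\mathbf{GL}_n(K)$ for some $n\geq 1$; (4) $H$ can be made to act linearly and freely on a sphere $\mathbf{S}_{n-1}$ for some $n\geq 1$, i.e. for some $n\ge 1$ there is a linear action of $H$ on $\mathbf{R}^n$ which maps the unit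 sphere $\mathbf{S}_{n-1}=\{x\in\mathbf R^n:\sum_i x_i^2=1\}$ to itself and whose restriction to $\mathbf{S}_{n-1}$ is free. -/

import Mathlib

universe u v w x

/-- `(G, H)` is a Frobenius pair: `G` is a finite group, `H` is a subgroup of `G` distinct from
`{1}` and from `G`, and the union of the conjugates `g H g⁻¹` has the largest possible number
of elements, namely `|G| - (|G|/|H| - 1)`. -/
def IsFrobeniusPair (G : Type v) [Group G] (H : Subgroup G) : Prop :=
  Finite G ∧ H ≠ ⊥ ∧ H ≠ ⊤ ∧
    (((⋃ g : G, (fun h : G => g * h * g⁻¹) '' (H : Set G)).ncard : ℕ) : ℚ) =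
      (Nat.card G : ℚ) - ((Nat.card G : ℚ) / (Nat.card H : ℚ) - 1)

/-- The group `H` is (up to isomorphism) the complement in some Frobenius pair. -/
def IsFrobeniusComplement (H : Type u) [Group H] : Prop :=
  ∃ (G : Type v) (_ : Group G) (H' : Subgroup G), Nonempty (H ≃* H') ∧ IsFrobeniusPair G H'

/-- A linear representation `H → GL_n(K)` is fixed-point-free if `H` acts freely
on `K ^ n - {0}`. -/
def IsFixedPointFreeRep {H : Type u} [Group H] {K : Type v} [Field K] {n : ℕ}
    (ρ : H →* Matrix.GeneralLinearGroup (Fin n) K) : Prop :=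
  ∀ (h : H) (x : Fin n → K), x ≠ 0 → (ρ h : Matrix (Fin n) (Fin n) K).mulVec x = x → h = 1

/-- `H` has a fixed-point-free linear representation of some degree `n ≥ 1` over `K`. -/
def HasFixedPointFreeRep (H : Type u) [Group H] (K : Type v) [Field K] : Prop :=
  ∃ n : ℕ, 1 ≤ n ∧ ∃ ρ : H →* Matrix.GeneralLinearGroup (Fin n) K, IsFixedPointFreeRep ρ

/-- `H` acts linearly and freely on some unit sphere `S_{n-1}` of `ℝ ^ n`, `n ≥ 1`: there is a
linear action of `H` on Euclidean `n`-space which maps the unit sphere to itself, and whose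
restriction to the sphere is free. -/
def ActsLinearlyFreelyOnSphere (H : Type u) [Group H] : Prop :=
  ∃ n : ℕ, 1 ≤ n ∧ ∃ ρ : Representation ℝ H (EuclideanSpace ℝ (Fin n)),
    (∀ h : H, ∀ x ∈ Metric.sphere (0 : EuclideanSpace ℝ (Fin n)) 1,
      ρ h x ∈ Metric.sphere (0 : EuclideanSpace ℝ (Fin n)) 1) ∧
    (∀ h : H, ∀ x ∈ Metric.sphere (0 : EuclideanSpace ℝ (Fin n)) 1, ρ h x = x → h = 1)

/-!
The four properties are each shown equivalent to one linear-algebraic condition over `ℚ`. For a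
commutative ring `R`, let `cosetSumZero H R` be the module of functions `f : H → R` whose sum over
every left coset of every nontrivial cyclic subgroup vanishes; the condition is
`cosetSumZero H ℚ ≠ ⊥`.

*Representations.* A matrix coefficient of a fixed-point-free representation has vanishing coset
sums, since the sum of `ρ c ^ i v` over the powers of `c ≠ 1` is fixed by `c`. Conversely, if `|H|`
is invertible, left translation on `cosetSumZero H K` is fixed-point-free. A fixed-point-free
representation exists only in characteristic prime to `|H|`
(`natCard_ne_zero_of_fixedPointFree`).

*Change of field.* The defining equations have integer coefficients, so a linear functional carries
solutions between a field and its prime field, and a primitive integral solution reduces to a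
nonzero solution modulo `p`. The step from `ZMod p` to `ℚ`, for `p` prime to `|H|`, goes through the
group algebra: the solutions form a two-sided ideal, which is generated by a central idempotent,
and this idempotent lifts to a central idempotent modulo `p ^ n` that still solves the equations
(`exists_cosetSumZero_zmod_pow`). If there were no rational solution, a left inverse of the matrix
of the system, cleared of denominators, would bound `p ^ n`. The outcome is
`cosetSumZero_ne_bot_iff_rat`.

*Spheres.* Over `ℝ`, left translation is isometric for the standard inner product on `ℝ ^ H`.

*Frobenius pairs.* Counting shows that `(G, H)` is a Frobenius pair exactly when `H` is proper,
nontrivial and meets `g H g⁻¹` trivially for `g ∉ H` (`isFrobeniusPair_iff`). A fixed-point-free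
representation over `ZMod p` gives such a pair by the semidirect product. In the other direction,
Frobenius's theorem (`Subgroup.IsMalnormal.exists_normal_complement`) supplies the normal kernel
`N`: for each irreducible character `χ` of `H`, the class function `Ind (χ - χ(1)) + χ(1)` has norm
one and integral products with all characters, so it is an irreducible character of `G`, and `N` is
the intersection of the kernels of the corresponding representations. For a prime `p` dividing
`|N|`, Frattini's argument and the Schur–Zassenhaus theorem give a complement of `N` normalizing a
Sylow `p`-subgroup `P` of `N`. It is isomorphic to `H`, and its nontrivial elements are conjugate
into `H`, so it acts without fixed points on the elements of order `p` in the center of `P`.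
-/

/-! ### Functions with vanishing coset sums -/

section CosetSumZero

open Finset

/-- The functions `f : H → R` whose sum over every left coset `g⟨c⟩` of every nontrivial cyclic
subgroup vanishes. The coset is listed as `g, g c, …, g c ^ (orderOf c - 1)`; an element `c` of
infinite order, for which `orderOf c = 0`, imposes no condition. -/
def cosetSumZero (H : Type*) [Group H] (R : Type*) [CommRing R] : Submodule R (H → R) where
  carrier := {f | ∀ g c : H, c ≠ 1 → ∑ i ∈ range (orderOf c), f (g * c ^ i) = 0}
  add_mem' := by
    intro a b ha hb g c hc
    simp [Finset.sum_add_distrib, ha g c hc, hb g c hc]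
  zero_mem' := by intro g c _; simp
  smul_mem' := by
    intro r a ha g c hc
    simp [← Finset.mul_sum, ha g c hc]

variable {H : Type*} [Group H]

/-- The sum of the powers of `c` is invariant under multiplication by `c`. -/
theorem map_mul_sum_range_orderOf {A : Type*} [Ring A] (φ : H →* A) (c : H) :
    φ c * ∑ i ∈ range (orderOf c), φ (c ^ i) = ∑ i ∈ range (orderOf c), φ (c ^ i) := by
  have h1 := Finset.sum_range_succ (fun i => φ (c ^ i)) (orderOf c)
  rw [Finset.sum_range_succ', pow_orderOf_eq_one, pow_zero] at h1
  rw [Finset.mul_sum, ← add_right_cancel h1]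
  simp only [pow_succ', map_mul]

/-- A matrix coefficient `h ↦ l (ρ h v)` of a fixed-point-free representation has vanishing coset
sums: the sum of `ρ c ^ i v` over the powers of `c` is fixed by `c`, hence zero. -/
theorem cosetSumZero_ne_bot_of_fixedPointFree {K V : Type*} [Field K] [AddCommGroup V] [Module K V]
    [Nontrivial V] (ρ : Representation K H V)
    (hρ : ∀ (h : H) (x : V), x ≠ 0 → ρ h x = x → h = 1) : cosetSumZero H K ≠ ⊥ := by
  obtain ⟨v, hv⟩ := exists_ne (0 : V)
  obtain ⟨l, hl⟩ := Module.Projective.exists_dual_ne_zero K hv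
  intro hb
  have hmem : (fun h => l (ρ h v)) ∈ cosetSumZero H K := by
    intro g c hc
    have hs : ∑ i ∈ range (orderOf c), ρ (c ^ i) v = 0 := by
      by_contra h0
      refine hc (hρ c _ h0 ?_)
      have := congrArg (fun T : V →ₗ[K] V => T v) (map_mul_sum_range_orderOf ρ c)
      simpa [LinearMap.sum_apply] using this
    simp only [map_mul, Module.End.mul_apply]
    rw [← map_sum, ← map_sum, hs, map_zero, map_zero]
  rw [hb, Submodule.mem_bot] at hmem
  exact hl (by simpa using congrFun hmem 1)

/-- The left translation representation on the functions with vanishing coset sums. -/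
def cosetSumZeroRep (H : Type*) [Group H] (R : Type*) [CommRing R] :
    Representation R H (cosetSumZero H R) where
  toFun h := (LinearMap.funLeft R R (fun x => h⁻¹ * x)).restrict (by
    intro f hf g c hc
    simpa [LinearMap.funLeft_apply, mul_assoc] using hf (h⁻¹ * g) c hc)
  map_one' := by ext; simp [LinearMap.funLeft_apply]
  map_mul' a b := by
    ext f x
    change (f : H → R) ((a * b)⁻¹ * x) = (f : H → R) (b⁻¹ * (a⁻¹ * x))
    rw [mul_inv_rev, mul_assoc]

theorem cosetSumZeroRep_apply {R : Type*} [CommRing R] (h : H) (f : cosetSumZero H R) (x : H) :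
    (cosetSumZeroRep H R h f : H → R) x = (f : H → R) (h⁻¹ * x) := rfl

theorem natCast_orderOf_ne_zero [Finite H] {K : Type*} [Field K]
    (hK : (Nat.card H : K) ≠ 0) (c : H) : (orderOf c : K) ≠ 0 := by
  obtain ⟨k, hk⟩ := orderOf_dvd_natCard c
  rw [hk] at hK
  push_cast at hK
  exact left_ne_zero_of_mul hK

/-- A function fixed by left translation by `h` is constant on the right cosets of `⟨h⟩`. These are
left cosets of conjugate subgroups, so the sum over such a coset is `orderOf h` times the value. -/
theorem eq_zero_of_forall_translate_eq [Finite H] {K : Type*} [Field K]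
    (hK : (Nat.card H : K) ≠ 0) {f : H → K} (hf : f ∈ cosetSumZero H K) {h : H} (hh : h ≠ 1)
    (hfix : ∀ x, f (h⁻¹ * x) = f x) : f = 0 := by
  have hfix' : ∀ (i : ℕ) x, f (h ^ i * x) = f x := by
    intro i
    induction i with
    | zero => simp
    | succ k ih =>
      intro x
      rw [← hfix, pow_succ', mul_assoc, inv_mul_cancel_left, ih]
  funext x
  have hc : x⁻¹ * h * x ≠ 1 := by
    intro h1
    apply hh
    have : h = x * (x⁻¹ * h * x) * x⁻¹ := by group
    rw [this, h1]; simp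
  have hpow : ∀ i : ℕ, x * (x⁻¹ * h * x) ^ i = h ^ i * x := by
    intro i
    have := conj_pow (a := x⁻¹) (b := h) (i := i)
    rw [inv_inv] at this
    rw [this]; group
  have h2 := hf x _ hc
  simp only [hpow, hfix', Finset.sum_const, card_range, nsmul_eq_mul] at h2
  simpa [natCast_orderOf_ne_zero hK] using h2

theorem cosetSumZeroRep_fixedPointFree [Finite H] {K : Type*} [Field K]
    (hK : (Nat.card H : K) ≠ 0) (h : H) (f : cosetSumZero H K) (hf : f ≠ 0)
    (hfix : cosetSumZeroRep H K h f = f) : h = 1 := by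
  by_contra hh
  apply hf
  apply Subtype.ext
  refine eq_zero_of_forall_translate_eq hK f.2 hh fun x => ?_
  rw [← cosetSumZeroRep_apply, hfix]

theorem map_mem_cosetSumZero {R S : Type*} [CommRing R] [CommRing S] (φ : R →+ S)
    {f : H → R} (hf : f ∈ cosetSumZero H R) : (fun h => φ (f h)) ∈ cosetSumZero H S := by
  intro g c hc
  rw [← map_sum, hf g c hc, map_zero]

/-- The equations have integer coefficients, so a nonzero solution over an extension field gives
one over the base field by applying a linear functional, and conversely. -/
theorem cosetSumZero_ne_bot_iff_of_algebra (F K : Type*) [Field F] [Field K] [Algebra F K] :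
    cosetSumZero H K ≠ ⊥ ↔ cosetSumZero H F ≠ ⊥ := by
  constructor
  · intro h
    obtain ⟨f, hf, hf0⟩ := Submodule.exists_mem_ne_zero_of_ne_bot h
    obtain ⟨x, hx⟩ := Function.ne_iff.mp hf0
    obtain ⟨l, hl⟩ := Module.Projective.exists_dual_ne_zero F hx
    have := map_mem_cosetSumZero l.toAddMonoidHom hf
    intro hb
    rw [hb, Submodule.mem_bot] at this
    exact hl (congrFun this x)
  · intro h
    obtain ⟨f, hf, hf0⟩ := Submodule.exists_mem_ne_zero_of_ne_bot h
    obtain ⟨x, hx⟩ := Function.ne_iff.mp hf0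
    have := map_mem_cosetSumZero (algebraMap F K).toAddMonoidHom hf
    intro hb
    rw [hb, Submodule.mem_bot] at this
    exact hx (by simpa using congrFun this x)

end CosetSumZero

/-! ### Integral solutions and reduction modulo a prime -/

section

open Finset
variable {H : Type*} [Group H]

theorem cosetSumZero_int_ne_bot [Finite H] (h : cosetSumZero H ℚ ≠ ⊥) : cosetSumZero H ℤ ≠ ⊥ := by
  obtain ⟨f, hf, hf0⟩ := Submodule.exists_mem_ne_zero_of_ne_bot h
  obtain ⟨b, hb⟩ := IsLocalization.exist_integer_multiples_of_finite (nonZeroDivisors ℤ) f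
  choose F hF using hb
  have hb0 : ((b : ℤ) : ℚ) ≠ 0 := by
    exact_mod_cast nonZeroDivisors.ne_zero b.2
  have hF' : ∀ x, (F x : ℚ) = (b : ℤ) * f x := fun x => by simpa using hF x
  intro hbot
  have hmem : F ∈ cosetSumZero H ℤ := by
    intro g c hc
    have := hf g c hc
    have h2 : ((∑ i ∈ range (orderOf c), F (g * c ^ i) : ℤ) : ℚ) = 0 := by
      push_cast
      simp only [hF', ← Finset.mul_sum, this, mul_zero]
    exact_mod_cast h2
  rw [hbot, Submodule.mem_bot] at hmem
  apply hf0
  funext x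
  have := hF' x
  simpa [hmem, hb0] using this

/-- A primitive integral solution stays nonzero modulo `p`. -/
theorem cosetSumZero_zmod_ne_bot_of_rat [Finite H] (p : ℕ) [Fact p.Prime]
    (h : cosetSumZero H ℚ ≠ ⊥) : cosetSumZero H (ZMod p) ≠ ⊥ := by
  have := Fintype.ofFinite H
  obtain ⟨f, hf, hf0⟩ := Submodule.exists_mem_ne_zero_of_ne_bot (cosetSumZero_int_ne_bot h)
  obtain ⟨F, hF, hgcd⟩ := Finset.extract_gcd f (Finset.univ_nonempty (α := H))
  have hg : Finset.univ.gcd f ≠ 0 := by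
    rw [Ne, Finset.gcd_eq_zero_iff]
    intro h0
    exact hf0 (funext fun x => h0 x (mem_univ x))
  have hFmem : F ∈ cosetSumZero H ℤ := by
    intro g c hc
    have h1 := hf g c hc
    simp only [fun x => hF x (mem_univ x), ← Finset.mul_sum] at h1
    exact (mul_eq_zero.mp h1).resolve_left hg
  intro hb
  have h2 := map_mem_cosetSumZero (Int.castRingHom (ZMod p)).toAddMonoidHom hFmem
  rw [hb, Submodule.mem_bot] at h2
  have h3 : (p : ℤ) ∣ Finset.univ.gcd F := by
    refine Finset.dvd_gcd fun x _ => ?_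
    exact (ZMod.intCast_zmod_eq_zero_iff_dvd _ _).mp (congrFun h2 x)
  rw [hgcd] at h3
  exact (Fact.out : p.Prime).one_lt.ne' (by exact_mod_cast Int.eq_one_of_dvd_one (by positivity) h3)

/-- If the equations have no nonzero rational solution then their matrix has a rational left
inverse; a common denominator `N` of its entries bounds every modulus for which there is a
solution that is nonzero modulo `p`. -/
theorem exists_bound_of_cosetSumZero_rat_eq_bot [Finite H] (h : cosetSumZero H ℚ = ⊥) :
    ∃ N : ℤ, N ≠ 0 ∧ ∀ (q : ℕ) (F : H → ℤ),
      (∀ g c : H, c ≠ 1 → (q : ℤ) ∣ ∑ i ∈ range (orderOf c), F (g * c ^ i)) →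
      ∀ x, (q : ℤ) ∣ N * F x := by
  classical
  have := Fintype.ofFinite H
  let M : (H → ℚ) →ₗ[ℚ] (H × {c : H // c ≠ 1} → ℚ) :=
    LinearMap.pi fun j => ∑ i ∈ range (orderOf j.2.1), LinearMap.proj (j.1 * j.2.1 ^ i)
  have hM : ∀ f j, M f j = ∑ i ∈ range (orderOf j.2.1), f (j.1 * j.2.1 ^ i) := by
    intro f j; simp [M, LinearMap.sum_apply]
  have hker : LinearMap.ker M = ⊥ := by
    rw [eq_bot_iff, ← h]
    intro f hf g c hc
    rw [LinearMap.mem_ker] at hf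
    rw [← hM f (g, ⟨c, hc⟩), hf]; rfl
  obtain ⟨L, hL⟩ := LinearMap.exists_leftInverse_of_injective M hker
  let A := LinearMap.toMatrix' L
  obtain ⟨b, hb⟩ := IsLocalization.exist_integer_multiples_of_finite (nonZeroDivisors ℤ)
    (fun k : H × (H × {c : H // c ≠ 1}) => A k.1 k.2)
  choose B hB using hb
  have hB' : ∀ k, (B k : ℚ) = (b : ℤ) * A k.1 k.2 := fun k => by simpa using hB k
  refine ⟨b, nonZeroDivisors.ne_zero b.2, fun q F hF x => ?_⟩
  have h1 : (fun y => (F y : ℚ)) x = ∑ j, A x j * M (fun y => (F y : ℚ)) j := by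
    have h2 : L (M (fun y => (F y : ℚ))) = fun y => (F y : ℚ) := LinearMap.congr_fun hL _
    rw [← LinearMap.toMatrix'_mulVec] at h2
    exact (congrFun h2 x).symm
  have h3 : (b : ℤ) * F x = ∑ j : H × {c : H // c ≠ 1},
      B (x, j) * ∑ i ∈ range (orderOf j.2.1), F (j.1 * j.2.1 ^ i) := by
    have : (((b : ℤ) * F x : ℤ) : ℚ) = ((∑ j : H × {c : H // c ≠ 1},
      B (x, j) * ∑ i ∈ range (orderOf j.2.1), F (j.1 * j.2.1 ^ i) : ℤ) : ℚ) := by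
      push_cast
      simp only at h1
      rw [h1, Finset.mul_sum]
      refine Finset.sum_congr rfl fun j _ => ?_
      rw [hB', hM, mul_assoc]
    exact_mod_cast this
  rw [h3]
  exact Finset.dvd_sum fun j _ => (hF j.1 j.2.1 j.2.2).mul_left _

/-- A two-sided ideal of a semisimple ring is generated by a central idempotent. -/
theorem exists_central_idempotent_of_twoSided {A : Type*} [Ring A] [IsSemisimpleRing A]
    (J : Ideal A) (hJ : ∀ x ∈ J, ∀ a, x * a ∈ J) :
    ∃ e ∈ J, IsIdempotentElem e ∧ e ∈ Subring.center A ∧ ∀ x ∈ J, x * e = x := by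
  obtain ⟨e, he, rfl⟩ := IsSemisimpleRing.ideal_eq_span_idempotent J
  have hmem : e ∈ Ideal.span {e} := Ideal.mem_span_singleton_self e
  have hr : ∀ {f x : A}, IsIdempotentElem f → x ∈ Ideal.span {f} → x * f = x := by
    intro f x hf hx
    obtain ⟨a, rfl⟩ := Ideal.mem_span_singleton'.mp hx
    rw [mul_assoc, hf.eq]
  have hl : ∀ x ∈ Ideal.span {e}, e * x = x := by
    intro x hx
    -- the left ideal generated by `x - e x` squares to zero, so its idempotent generator vanishes
    set y := x - e * x with hy
    have hyJ : y ∈ Ideal.span {e} := Ideal.sub_mem _ hx (Ideal.mul_mem_left _ _ hx)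
    have hey : e * y = 0 := by rw [hy, mul_sub, ← mul_assoc, he.eq, sub_self]
    have hJy : ∀ z ∈ Ideal.span {e}, z * y = 0 := by
      intro z hz
      rw [← hr he hz, mul_assoc, hey, mul_zero]
    obtain ⟨f, hf, hfy⟩ := IsSemisimpleRing.ideal_eq_span_idempotent (Ideal.span {y})
    obtain ⟨a, ha⟩ := Ideal.mem_span_singleton'.mp
      (hfy ▸ Ideal.mem_span_singleton_self f : f ∈ Ideal.span {y})
    have hf0 : f = 0 := by
      rw [← hf.eq, ← ha]
      rw [← mul_assoc, hJy _ (hJ _ (Ideal.mul_mem_left _ a hyJ) a)]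
    have hy0 : y ∈ Ideal.span {f} := hfy ▸ Ideal.mem_span_singleton_self y
    rw [hf0] at hy0
    have : y = 0 := by simpa using hy0
    exact (sub_eq_zero.mp this).symm
  refine ⟨e, hmem, he, ?_, fun x hx => hr he hx⟩
  rw [Subring.mem_center_iff]
  intro a
  rw [← hl _ (Ideal.mul_mem_left _ a hmem), ← mul_assoc, hr he (hJ e hmem a)]

end

/-! ### The annihilator of the cyclic sums in the group algebra -/

section

open Finset
variable {H : Type*} [Group H]

/-- The sum of the powers of `c`, as an element of the group algebra. -/
noncomputable def cyclicSum (R : Type*) [Semiring R] (c : H) : MonoidAlgebra R H :=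
  ∑ i ∈ range (orderOf c), MonoidAlgebra.of R H (c ^ i)

theorem mul_cyclicSum_apply {R : Type*} [Ring R] (x : MonoidAlgebra R H) (c g : H) :
    (x * cyclicSum R c).coeff g = ∑ i ∈ range (orderOf c), x.coeff (g * c⁻¹ ^ i) := by
  simp [cyclicSum, Finset.mul_sum, MonoidAlgebra.of_apply]

/-- An element of the group algebra satisfies the coset equations exactly when it is annihilated
on the left by all sums over nontrivial cyclic subgroups. -/
theorem mem_cosetSumZero_iff_mul_cyclicSum {R : Type*} [CommRing R] (x : MonoidAlgebra R H) :
    (fun h => x.coeff h) ∈ cosetSumZero H R ↔ ∀ c : H, c ≠ 1 → x * cyclicSum R c = 0 := by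
  constructor
  · intro h c hc
    ext g
    rw [mul_cyclicSum_apply, ← orderOf_inv]
    simpa using h g c⁻¹ (inv_ne_one.mpr hc)
  · intro h g c hc
    have := mul_cyclicSum_apply x c⁻¹ g
    rw [h _ (inv_ne_one.mpr hc), orderOf_inv, inv_inv] at this
    simpa using this.symm

theorem cyclicSum_mul_self [Finite H] {R : Type*} [Ring R] (c : H) :
    cyclicSum R c * cyclicSum R c = (orderOf c : MonoidAlgebra R H) * cyclicSum R c := by
  have h1 : ∀ i, MonoidAlgebra.of R H (c ^ i) * cyclicSum R c = cyclicSum R c := by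
    intro i
    induction i with
    | zero => rw [pow_zero, map_one, one_mul]
    | succ k ih =>
      rw [pow_succ, map_mul, mul_assoc]
      rw [show MonoidAlgebra.of R H c * cyclicSum R c = cyclicSum R c from
        map_mul_sum_range_orderOf (MonoidAlgebra.of R H) c, ih]
  conv_lhs => rw [cyclicSum, Finset.sum_mul]
  rw [← cyclicSum]
  simp only [h1, Finset.sum_const, card_range, nsmul_eq_mul]

theorem of_mul_cyclicSum_conj {R : Type*} [Ring R] (h c : H) :
    MonoidAlgebra.of R H h * cyclicSum R c =
      cyclicSum R (h * c * h⁻¹) * MonoidAlgebra.of R H h := by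
  have ho : orderOf (h * c * h⁻¹) = orderOf c := by
    simpa using orderOf_injective (MulAut.conj h).toMonoidHom (MulAut.conj h).injective c
  simp only [cyclicSum, Finset.mul_sum, Finset.sum_mul, ho, ← map_mul]
  refine Finset.sum_congr rfl fun i _ => ?_
  rw [conj_pow]; group

/-- The elements of the group algebra annihilated by all nontrivial cyclic sums. -/
noncomputable def cyclicAnnihilator (H R : Type*) [Group H] [CommRing R] :
    Ideal (MonoidAlgebra R H) where
  carrier := {x | ∀ c : H, c ≠ 1 → x * cyclicSum R c = 0}
  add_mem' := by intro a b ha hb c hc; rw [add_mul, ha c hc, hb c hc, add_zero]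
  zero_mem' := by intro c _; rw [zero_mul]
  smul_mem' := by intro a x hx c hc; rw [smul_eq_mul, mul_assoc, hx c hc, mul_zero]

theorem mul_mem_cyclicAnnihilator {R : Type*} [CommRing R] {x : MonoidAlgebra R H}
    (hx : x ∈ cyclicAnnihilator H R) (a : MonoidAlgebra R H) : x * a ∈ cyclicAnnihilator H R := by
  induction a using MonoidAlgebra.induction_on with
  | of h =>
    intro c hc
    rw [mul_assoc, of_mul_cyclicSum_conj, ← mul_assoc, hx, zero_mul]
    intro h1
    apply hc
    simpa using h1
  | add f g hf hg => rw [mul_add]; exact Ideal.add_mem _ hf hg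
  | smul r f hf =>
    rw [mul_smul_comm]
    exact Submodule.smul_of_tower_mem _ r hf

theorem MonoidAlgebra.mem_center_iff_conj {R : Type*} [CommRing R] (x : MonoidAlgebra R H) :
    x ∈ Subring.center (MonoidAlgebra R H) ↔ ∀ g h : H, x.coeff (g * h * g⁻¹) = x.coeff h := by
  rw [Subring.mem_center_iff]
  constructor
  · intro hx g h
    have := congrArg (fun y : MonoidAlgebra R H => y.coeff (g * h)) (hx (MonoidAlgebra.of R H g))
    simpa [MonoidAlgebra.of_apply] using this.symm
  · intro hx a
    induction a using MonoidAlgebra.induction_on with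
    | of g =>
      ext h
      have := hx g (g⁻¹ * h)
      simpa [MonoidAlgebra.of_apply, mul_assoc] using this.symm
    | add f g hf hg => rw [mul_add, add_mul, hf, hg]
    | smul r f hf => rw [mul_smul_comm, smul_mul_assoc, hf]

end

/-! ### Lifting solutions from characteristic `p` to characteristic zero -/

section

open Finset
variable {H : Type*} [Group H]

/-- The idempotent generates the two-sided ideal formed by the solutions of the coset equations. -/
theorem exists_central_idempotent_of_cosetSumZero_ne_bot [Finite H] {k : Type*} [Field k]
    (hk : (Nat.card H : k) ≠ 0) (h : cosetSumZero H k ≠ ⊥) :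
    ∃ e ∈ cyclicAnnihilator H k, e ≠ 0 ∧ IsIdempotentElem e ∧
      e ∈ Subring.center (MonoidAlgebra k H) := by
  have : NeZero (Nat.card H : k) := ⟨hk⟩
  obtain ⟨f, hf, hf0⟩ := Submodule.exists_mem_ne_zero_of_ne_bot h
  obtain ⟨e, heJ, he, hec, her⟩ := exists_central_idempotent_of_twoSided (cyclicAnnihilator H k)
    fun x hx a => mul_mem_cyclicAnnihilator hx a
  refine ⟨e, heJ, ?_, he, hec⟩
  rintro rfl
  apply hf0
  let x : MonoidAlgebra k H := .ofCoeff (Finsupp.equivFunOnFinite.symm f)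
  have hx : x ∈ cyclicAnnihilator H k := (mem_cosetSumZero_iff_mul_cyclicSum x).mp hf
  have hx0 := her x hx
  rw [mul_zero] at hx0
  funext h
  have := congrArg (fun y : MonoidAlgebra k H => y.coeff h) hx0
  exact this.symm

theorem MonoidAlgebra.exists_center_lift [Finite H] {R S : Type*} [CommRing R] [CommRing S]
    {φ : R →+* S} (hφ : Function.Surjective φ) {e : MonoidAlgebra S H}
    (he : e ∈ Subring.center (MonoidAlgebra S H)) :
    ∃ x ∈ Subring.center (MonoidAlgebra R H), MonoidAlgebra.mapRingHom H φ x = e := by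
  -- lifting the coefficients through a fixed section keeps them constant on conjugacy classes
  refine ⟨.ofCoeff (Finsupp.equivFunOnFinite.symm
    fun h => Function.surjInv hφ (e.coeff h)), ?_, ?_⟩
  · rw [MonoidAlgebra.mem_center_iff_conj] at he ⊢
    intro g h
    simp [he g h]
  · ext h
    simp [Function.surjInv_eq hφ]

theorem MonoidAlgebra.pow_eq_zero_of_mapRingHom_zmod_eq_zero (p n : ℕ)
    {x : MonoidAlgebra (ZMod (p ^ n)) H} (hpn : p ∣ p ^ n)
    (hx : MonoidAlgebra.mapRingHom H (ZMod.castHom hpn (ZMod p)) x = 0) : x ^ n = 0 := by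
  have hdvd : ∀ h, (p : ZMod (p ^ n)) ∣ x.coeff h := by
    intro h
    have h1 := congrArg (fun y : MonoidAlgebra (ZMod p) H => y.coeff h) hx
    simp only [MonoidAlgebra.coeff_mapRingHom, MonoidAlgebra.coeff_zero, Finsupp.coe_zero,
      Pi.zero_apply] at h1
    obtain ⟨a, ha⟩ := ZMod.intCast_surjective (x.coeff h)
    rw [← ha] at h1 ⊢
    rw [map_intCast, ZMod.intCast_zmod_eq_zero_iff_dvd] at h1
    obtain ⟨b, rfl⟩ := h1
    exact ⟨b, by push_cast; ring⟩
  choose y hy using hdvd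
  have hxy : x = (p : ZMod (p ^ n)) •
      MonoidAlgebra.ofCoeff (Finsupp.onFinset x.coeff.support
        (fun h => if x.coeff h = 0 then 0 else y h) (by intro a; simp; tauto)) := by
    ext h
    by_cases h0 : x.coeff h = 0
    · simp [h0]
    · simp [h0, ← hy h]
  rw [hxy, smul_pow]
  have : (p : ZMod (p ^ n)) ^ n = 0 := by exact_mod_cast ZMod.natCast_self (p ^ n)
  rw [this, zero_smul]

/-- Solutions modulo `p` prime to `|H|` lift modulo `p ^ n`: the central idempotent `e` that
generates the annihilator of the cyclic sums lifts to a central idempotent `E`; since `E` commutes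
with each cyclic sum `s`, the product `E s` satisfies `(E s) ^ 2 = |c| E s` with `|c|` invertible,
and being nilpotent it vanishes. -/
theorem exists_cosetSumZero_zmod_pow [Finite H] (p : ℕ) [Fact p.Prime]
    (hp : (Nat.card H : ZMod p) ≠ 0) {e : MonoidAlgebra (ZMod p) H}
    (heJ : e ∈ cyclicAnnihilator H (ZMod p)) (he : IsIdempotentElem e)
    (hec : e ∈ Subring.center (MonoidAlgebra (ZMod p) H)) (n : ℕ) (hpn : p ∣ p ^ n) (hn : n ≠ 0) :
    ∃ f ∈ cosetSumZero H (ZMod (p ^ n)), ∀ h, ZMod.castHom hpn (ZMod p) (f h) = e.coeff h := by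
  set φ := MonoidAlgebra.mapRingHom H (ZMod.castHom hpn (ZMod p)) with hφ
  obtain ⟨x, hxc, hx⟩ := MonoidAlgebra.exists_center_lift (ZMod.castHom_surjective hpn) hec
  rw [← hφ] at hx
  have hnil : (x - x ^ 2) ^ n = 0 := by
    apply MonoidAlgebra.pow_eq_zero_of_mapRingHom_zmod_eq_zero p n hpn
    rw [← hφ, map_sub, map_pow, hx, pow_two, he.eq, sub_self]
  set E := 1 - (1 - x ^ n) ^ n with hE
  have hEi : IsIdempotentElem E := isIdempotentElem_one_sub_one_sub_pow_pow x n hnil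
  have hEc : E ∈ Subring.center (MonoidAlgebra (ZMod (p ^ n)) H) :=
    sub_mem (one_mem _) (pow_mem (sub_mem (one_mem _) (pow_mem hxc n)) n)
  have hφE : φ E = e := by
    rw [hE, map_sub, map_pow, map_sub, map_pow, map_one, hx, he.pow_eq hn, he.one_sub.pow_eq hn,
      sub_sub_cancel]
  refine ⟨fun h => E.coeff h, ?_, fun h => ?_⟩
  · rw [mem_cosetSumZero_iff_mul_cyclicSum]
    intro c hc
    have hsq : E * cyclicSum (ZMod (p ^ n)) c * (E * cyclicSum (ZMod (p ^ n)) c) =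
        (orderOf c : MonoidAlgebra (ZMod (p ^ n)) H) * (E * cyclicSum (ZMod (p ^ n)) c) :=
      calc E * cyclicSum _ c * (E * cyclicSum _ c)
          = (E * E) * (cyclicSum _ c * cyclicSum _ c) := by
            rw [mul_assoc, ← mul_assoc _ E, Subring.mem_center_iff.mp hEc (cyclicSum _ c)]
            simp only [mul_assoc]
        _ = _ := by rw [hEi.eq, cyclicSum_mul_self, ← mul_assoc, ← mul_assoc, Nat.cast_comm]
    have hpow : ∀ j, (E * cyclicSum _ c) ^ (j + 1) =
        (orderOf c : MonoidAlgebra (ZMod (p ^ n)) H) ^ j * (E * cyclicSum _ c) := by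
      intro j
      induction j with
      | zero => simp
      | succ j ih => rw [pow_succ, ih, mul_assoc, hsq, pow_succ, mul_assoc]
    have hzero : (E * cyclicSum _ c) ^ (n + 1) = 0 := by
      rw [pow_succ, MonoidAlgebra.pow_eq_zero_of_mapRingHom_zmod_eq_zero p n hpn, zero_mul]
      have hsum : φ (cyclicSum _ c) = cyclicSum _ c := by
        simp [cyclicSum, map_sum, hφ, MonoidAlgebra.of_apply, ZMod.cast_one hpn]
      rw [← hφ, map_mul, hφE, hsum]
      exact heJ c hc
    have hu : IsUnit ((orderOf c : MonoidAlgebra (ZMod (p ^ n)) H)) := by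
      have h1 : IsUnit (orderOf c : ZMod (p ^ n)) := by
        rw [ZMod.isUnit_iff_coprime]
        apply Nat.Coprime.pow_right
        rw [Nat.coprime_comm, (Fact.out : p.Prime).coprime_iff_not_dvd]
        rw [← ZMod.natCast_eq_zero_iff]
        exact natCast_orderOf_ne_zero hp c
      simpa using h1.map (algebraMap (ZMod (p ^ n)) (MonoidAlgebra (ZMod (p ^ n)) H))
    rw [hpow] at hzero
    exact ((hu.pow n).mul_right_eq_zero).mp hzero
  · rw [← hφE, hφ, MonoidAlgebra.coeff_mapRingHom]

/-- A solution modulo a prime not dividing `|H|` yields a rational solution. -/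
theorem cosetSumZero_rat_ne_bot_of_zmod [Finite H] (p : ℕ) [Fact p.Prime]
    (hp : (Nat.card H : ZMod p) ≠ 0) (h : cosetSumZero H (ZMod p) ≠ ⊥) :
    cosetSumZero H ℚ ≠ ⊥ := by
  have hprime : p.Prime := Fact.out
  intro hbot
  obtain ⟨N, hN0, hN⟩ := exists_bound_of_cosetSumZero_rat_eq_bot hbot
  obtain ⟨e, heJ, he0, he, hec⟩ := exists_central_idempotent_of_cosetSumZero_ne_bot hp h
  obtain ⟨x, hx⟩ : ∃ x, e.coeff x ≠ 0 := by
    by_contra! hall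
    exact he0 (by ext x; simpa using hall x)
  set n := N.natAbs + 1 with hn
  have hpn : p ∣ p ^ n := dvd_pow_self p (by omega)
  obtain ⟨f, hf, hfe⟩ := exists_cosetSumZero_zmod_pow p hp heJ he hec n hpn (by omega)
  choose F hF using fun h => ZMod.intCast_surjective (f h)
  have hdvd := hN (p ^ n) F (fun g c hc => by
    rw [← ZMod.intCast_zmod_eq_zero_iff_dvd]
    push_cast
    simp only [hF]
    exact hf g c hc) x
  have hcop : ¬ (p : ℤ) ∣ F x := by
    rw [← ZMod.intCast_zmod_eq_zero_iff_dvd, ← map_intCast (ZMod.castHom hpn (ZMod p)), hF, hfe]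
    exact hx
  have hcop' : IsCoprime ((p ^ n : ℕ) : ℤ) (F x) := by
    push_cast
    exact ((Nat.prime_iff_prime_int.mp hprime).coprime_iff_not_dvd.mpr hcop).pow_left
  have h1 : p ^ n ∣ N.natAbs := by
    have := hcop'.dvd_of_dvd_mul_right hdvd
    exact Int.natCast_dvd.mp this
  have h2 := Nat.le_of_dvd (Int.natAbs_pos.mpr hN0) h1
  have h3 := Nat.lt_pow_self hprime.one_lt (n := n)
  omega

/-- The existence of a nonzero function with vanishing coset sums does not depend on the field, as
long as its characteristic does not divide `|H|`. -/
theorem cosetSumZero_ne_bot_iff_rat [Finite H] {K : Type*} [Field K]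
    (hK : (Nat.card H : K) ≠ 0) : cosetSumZero H K ≠ ⊥ ↔ cosetSumZero H ℚ ≠ ⊥ := by
  obtain ⟨p, hp⟩ := CharP.exists K
  rcases CharP.char_is_prime_or_zero K p with hprime | rfl
  · have : Fact p.Prime := ⟨hprime⟩
    let _ := ZMod.algebra K p
    rw [cosetSumZero_ne_bot_iff_of_algebra (ZMod p) K]
    refine ⟨cosetSumZero_rat_ne_bot_of_zmod p ?_, cosetSumZero_zmod_ne_bot_of_rat p⟩
    rw [Ne, ZMod.natCast_eq_zero_iff]
    rwa [Ne, CharP.cast_eq_zero_iff K p] at hK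
  · have := CharP.charP_to_charZero K
    exact cosetSumZero_ne_bot_iff_of_algebra ℚ K

end

/-! ### Fixed-point-free representations and free actions on spheres -/

section

open Finset
variable {H : Type u} [Group H]

theorem hasFixedPointFreeRep_of_representation {K : Type v} [Field K] {V : Type*} [AddCommGroup V]
    [Module K V] [FiniteDimensional K V] [Nontrivial V] (ρ : Representation K H V)
    (hρ : ∀ (h : H) (x : V), x ≠ 0 → ρ h x = x → h = 1) : HasFixedPointFreeRep H K := by
  let b := Module.finBasis K V
  refine ⟨Module.finrank K V, Module.finrank_pos, MonoidHom.toHomUnits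
    (((LinearMap.toMatrixAlgEquiv b : _ →* _)).comp ρ), ?_⟩
  intro h x hx hfix
  refine hρ h (b.equivFun.symm x) (b.equivFun.symm.map_ne_zero_iff.mpr hx) ?_
  apply b.equivFun.injective
  rw [LinearEquiv.apply_symm_apply]
  have := LinearMap.toMatrix_mulVec_repr b b (ρ h) (b.equivFun.symm x)
  rw [← b.equivFun_apply, ← b.equivFun_apply, LinearEquiv.apply_symm_apply] at this
  rw [← this]
  exact hfix

/-- In characteristic `p`, an element of order `p` acts by a unipotent matrix, which fixes a
nonzero vector. -/
theorem natCard_ne_zero_of_fixedPointFree [Finite H] {K V : Type*} [Field K] [AddCommGroup V]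
    [Module K V] [Nontrivial V] (ρ : Representation K H V)
    (hρ : ∀ (h : H) (x : V), x ≠ 0 → ρ h x = x → h = 1) : (Nat.card H : K) ≠ 0 := by
  obtain ⟨p, hp⟩ := CharP.exists K
  intro h0
  rw [CharP.cast_eq_zero_iff K p] at h0
  rcases CharP.char_is_prime_or_zero K p with hprime | rfl
  · have : Fact p.Prime := ⟨hprime⟩
    obtain ⟨h, hh⟩ := exists_prime_orderOf_dvd_card' p h0
    have hh1 : h ≠ 1 := by
      rintro rfl
      exact hprime.one_lt.ne' (by simpa using hh.symm)
    have : CharP (Module.End K V) p := by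
      have := Module.End.instNontrivial (R := K) (M := V)
      exact charP_of_injective_algebraMap (algebraMap K (Module.End K V)).injective p
    have hnil : (ρ h - 1) ^ p = 0 := by
      rw [sub_pow_char_of_commute p (Commute.one_right _), one_pow, ← map_pow, ← hh,
        pow_orderOf_eq_one, map_one, sub_self]
    have hinj : Function.Injective (⇑(ρ h - 1 : Module.End K V)) := by
      rw [injective_iff_map_eq_zero]
      intro x hx
      by_contra hx0
      exact hh1 (hρ h x hx0 (by simpa [sub_eq_zero] using hx))
    have hinj' : Function.Injective (⇑((ρ h - 1 : Module.End K V) ^ p)) := by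
      rw [Module.End.coe_pow]
      exact hinj.iterate p
    rw [hnil] at hinj'
    obtain ⟨v, hv⟩ := exists_ne (0 : V)
    exact hv (hinj' (by simp))
  · exact Nat.card_pos.ne' (by simpa using h0)

theorem hasFixedPointFreeRep_iff_cosetSumZero_ne_bot [Finite H] {K : Type v} [Field K] :
    HasFixedPointFreeRep H K ↔ (Nat.card H : K) ≠ 0 ∧ cosetSumZero H K ≠ ⊥ := by
  constructor
  · rintro ⟨n, hn, ρ, hρ⟩
    have : Nonempty (Fin n) := ⟨⟨0, hn⟩⟩
    let σ : Representation K H (Fin n → K) :=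
      (Matrix.toLinAlgEquiv' (R := K) (n := Fin n)).toMulEquiv.toMonoidHom.comp
        ((Units.coeHom _).comp ρ)
    have hσ : ∀ (h : H) (x : Fin n → K), x ≠ 0 → σ h x = x → h = 1 := by
      intro h x hx hfix
      exact hρ h x hx (by simpa [σ] using hfix)
    exact ⟨natCard_ne_zero_of_fixedPointFree σ hσ, cosetSumZero_ne_bot_of_fixedPointFree σ hσ⟩
  · rintro ⟨hK, h⟩
    have := Submodule.nontrivial_iff_ne_bot.mpr h
    exact hasFixedPointFreeRep_of_representation (cosetSumZeroRep H K)
      (cosetSumZeroRep_fixedPointFree hK)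

theorem natCast_natCard_ne_zero_of_charZero [Finite H] (K : Type*) [Field K] [CharZero K] :
    (Nat.card H : K) ≠ 0 := by exact_mod_cast Nat.card_pos.ne'

theorem exists_hasFixedPointFreeRep_iff [Finite H] :
    (∃ (K : Type w) (_ : Field K), HasFixedPointFreeRep H K) ↔ cosetSumZero H ℚ ≠ ⊥ := by
  constructor
  · rintro ⟨K, _, h⟩
    rw [hasFixedPointFreeRep_iff_cosetSumZero_ne_bot] at h
    exact (cosetSumZero_ne_bot_iff_rat h.1).mp h.2
  · intro h
    have : CharZero (ULift.{w} ℚ) := charZero_of_injective_ringHom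
      (f := (ULift.ringEquiv (R := ℚ)).symm.toRingHom) (ULift.ringEquiv (R := ℚ)).symm.injective
    have h0 := natCast_natCard_ne_zero_of_charZero (H := H) (ULift.{w} ℚ)
    exact ⟨ULift.{w} ℚ, inferInstance, hasFixedPointFreeRep_iff_cosetSumZero_ne_bot.mpr
      ⟨h0, (cosetSumZero_ne_bot_iff_rat h0).mpr h⟩⟩

theorem forall_hasFixedPointFreeRep_iff [Finite H] :
    (∀ (K : Type x) [Field K], ¬ ringChar K ∣ Nat.card H → HasFixedPointFreeRep H K) ↔
      cosetSumZero H ℚ ≠ ⊥ := by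
  constructor
  · intro h
    have : CharZero (ULift.{x} ℚ) := charZero_of_injective_ringHom
      (f := (ULift.ringEquiv (R := ℚ)).symm.toRingHom) (ULift.ringEquiv (R := ℚ)).symm.injective
    refine exists_hasFixedPointFreeRep_iff.mp ⟨ULift.{x} ℚ, inferInstance, h _ ?_⟩
    rw [← ringChar.spec]
    exact natCast_natCard_ne_zero_of_charZero _
  · intro h K _ hK
    rw [← ringChar.spec] at hK
    exact hasFixedPointFreeRep_iff_cosetSumZero_ne_bot.mpr
      ⟨hK, (cosetSumZero_ne_bot_iff_rat hK).mpr h⟩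

/-- Left translation on `ℝ ^ H` permutes the coordinates, so it is isometric; its restriction to
the solutions of the coset equations, read in an orthonormal basis, acts freely on the sphere. -/
theorem actsLinearlyFreelyOnSphere_iff [Finite H] :
    ActsLinearlyFreelyOnSphere H ↔ cosetSumZero H ℚ ≠ ⊥ := by
  have := Fintype.ofFinite H
  have hR := natCast_natCard_ne_zero_of_charZero (H := H) ℝ
  rw [← cosetSumZero_ne_bot_iff_rat hR]
  constructor
  · rintro ⟨n, hn, ρ, -, hfree⟩
    have : Nonempty (Fin n) := ⟨⟨0, hn⟩⟩
    refine cosetSumZero_ne_bot_of_fixedPointFree ρ fun h x hx hfix => ?_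
    refine hfree h ((‖x‖⁻¹ : ℝ) • x) ?_ ?_
    · simp [norm_smul, hx]
    · rw [map_smul, hfix]
  · intro h
    let W : Submodule ℝ (EuclideanSpace ℝ H) :=
      (cosetSumZero H ℝ).comap (WithLp.linearEquiv 2 ℝ (H → ℝ)).toLinearMap
    let ε : W ≃ₗ[ℝ] cosetSumZero H ℝ :=
      (WithLp.linearEquiv 2 ℝ (H → ℝ)).submoduleMap W |>.trans
        (LinearEquiv.ofEq _ _ (Submodule.map_comap_eq_of_surjective
          (WithLp.linearEquiv 2 ℝ (H → ℝ)).surjective _))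
    have hε : ∀ (w : W) x, (ε w : H → ℝ) x = (w : EuclideanSpace ℝ H) x := fun w x => rfl
    have := Submodule.nontrivial_iff_ne_bot.mpr h
    have : Nontrivial W := ε.toEquiv.nontrivial
    let β := (stdOrthonormalBasis ℝ W).repr
    let ψ : EuclideanSpace ℝ (Fin (Module.finrank ℝ W)) ≃ₗ[ℝ] cosetSumZero H ℝ :=
      β.symm.toLinearEquiv.trans ε
    let ρ : Representation ℝ H (EuclideanSpace ℝ (Fin (Module.finrank ℝ W))) :=
      (ψ.symm.conjAlgEquiv ℝ : _ →* _).comp (cosetSumZeroRep H ℝ)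
    have hρ : ∀ h x, ψ (ρ h x) = cosetSumZeroRep H ℝ h (ψ x) := by
      intro h x
      simp [ρ]
    have hnorm : ∀ x, ‖x‖ ^ 2 = ∑ y, ‖(ψ x : H → ℝ) y‖ ^ 2 := by
      intro x
      have h1 : ‖x‖ = ‖((β.symm x : W) : EuclideanSpace ℝ H)‖ := by
        rw [← Submodule.coe_norm]
        exact (LinearIsometryEquiv.norm_map β.symm x).symm
      rw [h1, EuclideanSpace.norm_sq_eq]
      rfl
    refine ⟨Module.finrank ℝ W, Module.finrank_pos, ρ, ?_, ?_⟩
    · intro h x hx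
      rw [mem_sphere_zero_iff_norm] at hx ⊢
      rw [← hx, ← sq_eq_sq₀ (norm_nonneg _) (norm_nonneg _), hnorm, hnorm, hρ]
      exact Fintype.sum_equiv (Equiv.mulLeft h⁻¹) _ _ fun y => rfl
    · intro h x hx hfix
      refine cosetSumZeroRep_fixedPointFree hR h (ψ x) ?_ (by rw [← hρ, hfix])
      intro h0
      rw [LinearEquiv.map_eq_zero_iff] at h0
      simp [h0] at hx

end

/-! ### Frobenius pairs and malnormal subgroups -/

section

open Finset

/-- A subgroup meets its conjugates by outside elements trivially. -/
def Subgroup.IsMalnormal {G : Type*} [Group G] (H : Subgroup G) : Prop :=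
  ∀ g ∉ H, ∀ h ∈ H, g * h * g⁻¹ ∈ H → h = 1

variable {G : Type*} [Group G]

/-- Conjugates of the nontrivial elements of `H` by coset representatives; the image is the union
of the conjugates of `H` without `1`. -/
noncomputable def conjOut (H : Subgroup G) (x : (G ⧸ H) × {h : H // h ≠ 1}) : G :=
  x.1.out * (x.2.1 : G) * x.1.out⁻¹

theorem conj_eq_conjOut (H : Subgroup G) (g : G) (h : H) (hh : h ≠ 1) :
    ∃ k : {h : H // h ≠ 1}, conjOut H (g, k) = g * h * g⁻¹ := by
  obtain ⟨k, hk⟩ := QuotientGroup.mk_out_eq_mul H g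
  refine ⟨⟨k⁻¹ * h * k, fun h1 => hh ?_⟩, ?_⟩
  · have : h = k * (k⁻¹ * h * k) * k⁻¹ := by group
    rw [this, h1]; simp
  · simp only [conjOut, hk]
    push_cast
    group

theorem range_conjOut (H : Subgroup G) :
    Set.range (conjOut H) = (⋃ g : G, (fun h : G => g * h * g⁻¹) '' (H : Set G)) \ {1} := by
  ext x
  simp only [Set.mem_range, Set.mem_sdiff, Set.mem_iUnion, Set.mem_image, SetLike.mem_coe,
    Set.mem_singleton_iff]
  constructor
  · rintro ⟨⟨q, h⟩, rfl⟩
    refine ⟨⟨q.out, h.1, h.1.2, rfl⟩, fun h1 => h.2 ?_⟩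
    simpa [conjOut, mul_inv_eq_one] using h1
  · rintro ⟨⟨g, h, hh, rfl⟩, h1⟩
    obtain ⟨k, hk⟩ := conj_eq_conjOut H g ⟨h, hh⟩ (by
      rintro h2
      rw [Subgroup.mk_eq_one] at h2
      simp [h2] at h1)
    exact ⟨_, hk⟩

theorem conjOut_injective_iff (H : Subgroup G) :
    Function.Injective (conjOut H) ↔ H.IsMalnormal := by
  constructor
  · intro hinj g hg h hh hgh
    by_contra h1
    obtain ⟨k, hk⟩ := conj_eq_conjOut H g ⟨h, hh⟩ (by simpa using h1)
    obtain ⟨l, hl⟩ := conj_eq_conjOut H 1 ⟨g * h * g⁻¹, hgh⟩ (by simpa [mul_inv_eq_one] using h1)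
    have h2 := congrArg Prod.fst (hinj (hk.trans (by simpa using hl.symm)))
    simp only [QuotientGroup.eq, mul_one] at h2
    exact hg (by simpa using h2)
  · rintro hmal ⟨q, h⟩ ⟨r, k⟩ heq
    simp only [conjOut] at heq
    have h1 : (r.out⁻¹ * q.out) * h.1 * (r.out⁻¹ * q.out)⁻¹ = (k.1 : G) := by
      calc _ = r.out⁻¹ * (q.out * h.1 * q.out⁻¹) * r.out := by group
        _ = _ := by rw [heq]; group
    have h2 : r.out⁻¹ * q.out ∈ H := by
      by_contra hn
      refine h.2 (Subtype.ext (hmal _ hn _ h.1.2 ?_))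
      rw [h1]; exact k.1.2
    have h3 : r = q := by
      rw [← QuotientGroup.out_eq' r, ← QuotientGroup.out_eq' q]
      exact QuotientGroup.eq.mpr h2
    subst h3
    simp only [inv_mul_cancel, one_mul, inv_one, mul_one] at h1
    rw [Prod.mk.injEq]
    exact ⟨rfl, Subtype.ext (Subtype.ext h1)⟩

theorem natCard_conjOut_domain [Finite G] (H : Subgroup G) :
    Nat.card ((G ⧸ H) × {h : H // h ≠ 1}) = H.index * (Nat.card H - 1) := by
  have := Fintype.ofFinite H
  classical
  rw [Nat.card_prod, Subgroup.index]
  congr 1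
  rw [Nat.card_eq_fintype_card, Nat.card_eq_fintype_card, Fintype.card_subtype_compl]
  simp

/-- The union of the conjugates has the largest possible size exactly when the conjugates
meet trivially. -/
theorem ncard_iUnion_conj_eq_iff [Finite G] (H : Subgroup G) :
    (((⋃ g : G, (fun h : G => g * h * g⁻¹) '' (H : Set G)).ncard : ℕ) : ℚ) =
      (Nat.card G : ℚ) - ((Nat.card G : ℚ) / (Nat.card H : ℚ) - 1) ↔ H.IsMalnormal := by
  rw [← conjOut_injective_iff]
  have hpos : 0 < Nat.card H := Nat.card_pos
  have hone : (1 : G) ∈ ⋃ g : G, (fun h : G => g * h * g⁻¹) '' (H : Set G) :=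
    Set.mem_iUnion.mpr ⟨1, 1, H.one_mem, by simp⟩
  have h1 := Set.ncard_sdiff_singleton_add_one hone (Set.toFinite _)
  rw [← range_conjOut] at h1
  have h2 : (Nat.card G : ℚ) / (Nat.card H : ℚ) = H.index := by
    rw [← H.card_mul_index]
    push_cast
    field_simp
  have h3 : (Nat.card G : ℚ) = Nat.card H * H.index := by exact_mod_cast H.card_mul_index.symm
  have h4 : Function.Injective (conjOut H) ↔
      Nat.card ((G ⧸ H) × {h : H // h ≠ 1}) = (Set.range (conjOut H)).ncard := by
    rw [Set.ncard_def]
    have hs := Set.rangeFactorization_surjective (f := conjOut H)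
    rw [← Set.rangeFactorization_injective]
    constructor
    · intro h
      exact Nat.card_congr (Equiv.ofBijective _ ⟨h, hs⟩)
    · intro h
      exact ((Nat.bijective_iff_surjective_and_card _).mpr ⟨hs, h⟩).1
  rw [h4, natCard_conjOut_domain, ← h1, h2, h3]
  have h5 : ((H.index * (Nat.card H - 1) : ℕ) : ℚ) = Nat.card H * H.index - H.index := by
    rw [Nat.cast_mul, Nat.cast_sub hpos]; push_cast; ring
  constructor
  · intro h
    have : ((H.index * (Nat.card H - 1) : ℕ) : ℚ) = ((Set.range (conjOut H)).ncard : ℕ) := by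
      rw [h5]; push_cast at h; linarith
    exact_mod_cast this
  · intro h
    rw [← h]
    push_cast at h5 ⊢
    linarith

theorem isFrobeniusPair_iff (H : Subgroup G) :
    IsFrobeniusPair G H ↔ Finite G ∧ H ≠ ⊥ ∧ H ≠ ⊤ ∧ H.IsMalnormal := by
  refine and_congr_right fun hG => and_congr_right fun _ => and_congr_right fun _ => ?_
  exact ncard_iUnion_conj_eq_iff H

end

/-! ### Frobenius pairs from fixed-point-free representations -/

section

open Finset

theorem IsFrobeniusPair.map_mulEquiv {G : Type*} {G' : Type*} [Group G] [Group G'] {H : Subgroup G}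
    (h : IsFrobeniusPair G H) (e : G ≃* G') : IsFrobeniusPair G' (H.map e.toMonoidHom) := by
  rw [isFrobeniusPair_iff] at h ⊢
  obtain ⟨hG, hbot, htop, hmal⟩ := h
  refine ⟨Finite.of_equiv G e.toEquiv, ?_, ?_, ?_⟩
  · rwa [Ne, Subgroup.map_eq_bot_iff_of_injective _ e.injective]
  · intro h
    apply htop
    rw [eq_top_iff]
    intro x _
    have hx : e x ∈ H.map e.toMonoidHom := h ▸ Subgroup.mem_top _
    exact (Subgroup.mem_map_iff_mem e.injective).mp hx
  · intro g hg h hh hgh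
    obtain ⟨g, rfl⟩ := e.surjective g
    obtain ⟨h, hmem, rfl⟩ := Subgroup.mem_map.mp hh
    have h1 : h = 1 := by
      refine hmal g (fun hgH => hg (Subgroup.mem_map_of_mem _ hgH)) h hmem ?_
      exact (Subgroup.mem_map_iff_mem (f := e.toMonoidHom) e.injective).mp (by simpa using hgh)
    simp [h1]

/-- A fixed-point-free action by automorphisms gives a Frobenius pair. -/
theorem isFrobeniusPair_semidirectProduct {N H : Type*} [Group N] [Group H] [Finite N] [Finite H]
    [Nontrivial N] [Nontrivial H] (φ : H →* MulAut N)
    (hφ : ∀ (h : H) (n : N), n ≠ 1 → φ h n = n → h = 1) :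
    IsFrobeniusPair (N ⋊[φ] H) (SemidirectProduct.inr : H →* N ⋊[φ] H).range := by
  rw [isFrobeniusPair_iff]
  have hmem : ∀ g : N ⋊[φ] H, g ∈ (SemidirectProduct.inr : H →* N ⋊[φ] H).range ↔ g.left = 1 := by
    intro g
    constructor
    · rintro ⟨h, rfl⟩; rfl
    · intro h
      exact ⟨g.right, SemidirectProduct.ext h.symm rfl⟩
  refine ⟨Finite.of_equiv _ SemidirectProduct.equivProd.symm, ?_, ?_, ?_⟩
  · obtain ⟨h, hh⟩ := exists_ne (1 : H)
    intro hbot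
    have : SemidirectProduct.inr h ∈ (SemidirectProduct.inr : H →* N ⋊[φ] H).range := ⟨h, rfl⟩
    rw [hbot, Subgroup.mem_bot] at this
    exact hh (by simpa using congrArg SemidirectProduct.right this)
  · obtain ⟨n, hn⟩ := exists_ne (1 : N)
    intro htop
    have : (SemidirectProduct.inl n : N ⋊[φ] H) ∈ (SemidirectProduct.inr : H →* N ⋊[φ] H).range :=
      htop ▸ Subgroup.mem_top _
    rw [hmem] at this
    exact hn this
  · rintro g hg _ ⟨h, rfl⟩ hgh
    rw [hmem] at hg hgh
    have h1 : φ (g.right * h * g.right⁻¹) g.left = g.left := by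
      simp only [SemidirectProduct.mul_left, SemidirectProduct.mul_right, SemidirectProduct.left_inr,
        SemidirectProduct.right_inr, SemidirectProduct.inv_left, map_one, mul_one, map_inv,
        mul_inv_eq_one] at hgh
      conv_rhs => rw [hgh]
      simp
    have h2 := hφ _ _ hg h1
    rw [conj_eq_one_iff] at h2
    rw [h2, map_one]

/-- The action by automorphisms on the multiplicative copy of the underlying group of a
representation. -/
def Representation.toMulAut {k G V : Type*} [Semiring k] [Group G] [AddCommGroup V] [Module k V]
    (ρ : Representation k G V) : G →* MulAut (Multiplicative V) where
  toFun g :=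
    { toFun := fun v => .ofAdd (ρ g v.toAdd)
      invFun := fun v => .ofAdd (ρ g⁻¹ v.toAdd)
      left_inv := fun v => by simp
      right_inv := fun v => by simp
      map_mul' := fun v w => by simp }
  map_one' := by ext; simp
  map_mul' a b := by ext; simp

theorem isFrobeniusComplement_of_cosetSumZero {H : Type u} [Group H] [Finite H] [Nontrivial H]
    (h : cosetSumZero H ℚ ≠ ⊥) : IsFrobeniusComplement.{u, v} H := by
  obtain ⟨p, hp, hprime⟩ := Nat.exists_infinite_primes (Nat.card H + 1)
  have : Fact p.Prime := ⟨hprime⟩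
  have hcard : (Nat.card H : ZMod p) ≠ 0 := by
    rw [Ne, ZMod.natCast_eq_zero_iff]
    intro hdvd
    have := Nat.le_of_dvd Nat.card_pos hdvd
    omega
  have hW := (cosetSumZero_ne_bot_iff_rat hcard).mpr h
  have := Submodule.nontrivial_iff_ne_bot.mpr hW
  have := Fintype.ofFinite H
  have : Finite (Multiplicative (cosetSumZero H (ZMod p))) :=
    inferInstanceAs (Finite (cosetSumZero H (ZMod p)))
  let φ := (cosetSumZeroRep H (ZMod p)).toMulAut
  have hpair := isFrobeniusPair_semidirectProduct φ fun h f hf hfix =>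
    cosetSumZeroRep_fixedPointFree hcard h f.toAdd hf hfix
  have : Finite (Multiplicative (cosetSumZero H (ZMod p)) ⋊[φ] H) := hpair.1
  let e := (Shrink.mulEquiv.{v} (α := Multiplicative (cosetSumZero H (ZMod p)) ⋊[φ] H)).symm
  refine ⟨_, inferInstance, _, ⟨?_⟩, hpair.map_mulEquiv e⟩
  exact (MonoidHom.ofInjective SemidirectProduct.inr_injective).trans
    (Subgroup.equivMapOfInjective _ _ e.injective)

end

/-! ### Complex representations of finite groups are unitary -/

section

open Finset

open scoped MatrixOrder ComplexOrder in
/-- Every representation of a finite group by complex matrices is conjugate to a unitary one: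
`P = ∑ (R g)ᴴ R g` is positive definite and invariant, and `P = yᴴ y` for an invertible `y`. -/
theorem exists_conj_unitary {G n : Type*} [Group G] [Fintype G] [Fintype n] [DecidableEq n]
    (R : G →* Matrix n n ℂ) :
    ∃ y : (Matrix n n ℂ)ˣ, ∀ g, star (y.1 * R g * y⁻¹.1) * (y.1 * R g * y⁻¹.1) = 1 := by
  classical
  set P : Matrix n n ℂ := ∑ g, star (R g) * R g with hP
  have hpos : P.PosDef := by
    rw [hP, ← Finset.add_sum_erase _ _ (mem_univ (1 : G)), map_one, star_one, one_mul]
    refine Matrix.PosDef.one.add_posSemidef ?_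
    exact Matrix.posSemidef_sum _ fun g _ => Matrix.posSemidef_conjTranspose_mul_self _
  have hinv : ∀ h, star (R h) * P * R h = P := by
    intro h
    rw [hP, Finset.mul_sum, Finset.sum_mul]
    refine Fintype.sum_equiv (Equiv.mulRight h) _ _ fun g => ?_
    simp [star_mul, mul_assoc]
  obtain ⟨y, hy, hPy⟩ := CStarAlgebra.isStrictlyPositive_iff_eq_star_mul_self.mp
    hpos.isStrictlyPositive
  obtain ⟨y, rfl⟩ := hy
  refine ⟨y, fun g => ?_⟩
  have h1 : star (y⁻¹.1) * star y.1 = 1 := by rw [← star_mul, Units.mul_inv, star_one]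
  calc _ = star (y⁻¹.1) * (star (R g) * (star y.1 * y.1) * R g) * y⁻¹.1 := by
        simp only [star_mul, mul_assoc]
    _ = star (y⁻¹.1) * star y.1 * (y.1 * y⁻¹.1) := by
        rw [← hPy, hinv, hPy]; simp only [mul_assoc]
    _ = 1 := by rw [h1, Units.mul_inv, one_mul]

namespace Representation

variable {G V : Type*} [Group G] [Finite G] [AddCommGroup V] [Module ℂ V] [FiniteDimensional ℂ V]
  (ρ : Representation ℂ G V)

/-- Matrices of `ρ` in a basis that is orthonormal for an invariant inner product; only the traces
and the kernel are needed from the change of basis. -/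
theorem exists_unitary_matrices :
    ∃ U : G → Matrix (Fin (Module.finrank ℂ V)) (Fin (Module.finrank ℂ V)) ℂ,
      (∀ g, star (U g) * U g = 1) ∧ (∀ g, U g⁻¹ = star (U g)) ∧
      (∀ g, ρ.character g = (U g).trace) ∧ (∀ g, U g = 1 → ρ g = 1) := by
  have := Fintype.ofFinite G
  let b := Module.finBasis ℂ V
  let R : G →* Matrix (Fin (Module.finrank ℂ V)) (Fin (Module.finrank ℂ V)) ℂ :=
    (LinearMap.toMatrixAlgEquiv b).toMulEquiv.toMonoidHom.comp ρ
  obtain ⟨y, hy⟩ := exists_conj_unitary R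
  refine ⟨fun g => y.1 * R g * y⁻¹.1, hy, fun g => ?_, fun g => ?_, fun g hg => ?_⟩
  · refine (left_inv_eq_right_inv (hy g) ?_).symm
    calc _ = y.1 * R g * (y⁻¹.1 * y.1) * R g⁻¹ * y⁻¹.1 := by simp only [mul_assoc]
      _ = y.1 * (R g * R g⁻¹) * y⁻¹.1 := by rw [Units.inv_mul, mul_one]; simp only [mul_assoc]
      _ = 1 := by rw [← map_mul, mul_inv_cancel, map_one, mul_one, Units.mul_inv]
  · rw [Matrix.trace_mul_comm, ← mul_assoc, Units.inv_mul, one_mul, character,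
      LinearMap.trace_eq_matrix_trace ℂ b]
    rfl
  · beta_reduce at hg
    have h1 : R g = 1 := by
      calc R g = y⁻¹.1 * (y.1 * R g * y⁻¹.1) * y.1 := by
            simp only [mul_assoc, Units.inv_mul, mul_one, Units.inv_mul_cancel_left]
        _ = 1 := by rw [hg, mul_one, Units.inv_mul]
    exact (LinearMap.toMatrixAlgEquiv b).injective (h1.trans (map_one _).symm)

theorem character_inv (g : G) : ρ.character g⁻¹ = star (ρ.character g) := by
  obtain ⟨U, -, hinv, htr, -⟩ := ρ.exists_unitary_matrices
  rw [htr, htr, hinv, Matrix.star_eq_conjTranspose, Matrix.trace_conjTranspose]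

open scoped ComplexOrder in
/-- A unitary matrix `U` of trace `n` satisfies `tr ((U - 1)ᴴ (U - 1)) = 0`. -/
theorem eq_one_of_character_eq_finrank {g : G} (h : ρ.character g = Module.finrank ℂ V) :
    ρ g = 1 := by
  obtain ⟨U, hU, -, htr, hone⟩ := ρ.exists_unitary_matrices
  apply hone
  rw [← sub_eq_zero, ← Matrix.trace_conjTranspose_mul_self_eq_zero_iff]
  have h1 : (U g - 1).conjTranspose * (U g - 1) = star (U g) * U g - star (U g) - U g + 1 := by
    rw [Matrix.conjTranspose_sub, Matrix.conjTranspose_one, Matrix.star_eq_conjTranspose]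
    noncomm_ring
  rw [h1, hU, Matrix.trace_add, Matrix.trace_sub, Matrix.trace_sub, Matrix.star_eq_conjTranspose,
    Matrix.trace_conjTranspose, ← htr, h, Matrix.trace_one]
  simp

end Representation
end

/-! ### Irreducible characters and class functions -/

section

open Finset

theorem Representation.asAlgebraHom_ofModule' {k G M : Type*} [Field k] [Group G] [AddCommGroup M]
    [Module k M] [Module (MonoidAlgebra k G) M] [IsScalarTower k (MonoidAlgebra k G) M]
    (t : MonoidAlgebra k G) (m : M) :
    (Representation.ofModule' (k := k) (G := G) M).asAlgebraHom t m = t • m :=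
  LinearMap.congr_fun (AlgHom.congr_fun
    ((MonoidAlgebra.lift k (Module.End k M) G).apply_symm_apply (Algebra.lsmul k k M)) t) m

theorem Representation.isIrreducible_ofModule' {k G M : Type*} [Field k] [Group G]
    [AddCommGroup M] [Module k M] [Module (MonoidAlgebra k G) M]
    [IsScalarTower k (MonoidAlgebra k G) M] [IsSimpleModule (MonoidAlgebra k G) M] :
    (Representation.ofModule' (k := k) (G := G) M).IsIrreducible := by
  rw [Representation.irreducible_iff_isSimpleModule_asModule]
  let e : (Representation.ofModule' (k := k) (G := G) M).asModule ≃ₗ[MonoidAlgebra k G] M :=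
    { (Representation.ofModule' (k := k) (G := G) M).asModuleEquiv with
      map_smul' := fun t m => Representation.asAlgebraHom_ofModule' (M := M) t
        ((Representation.ofModule' (k := k) (G := G) M).asModuleEquiv m) }
  exact IsSimpleModule.congr e

/-- An element of the group algebra acting as zero on all irreducible representations is zero,
because the regular module is a sum of simple submodules. -/
theorem MonoidAlgebra.eq_zero_of_forall_irreducible {k : Type v} {G : Type u} [Field k] [Group G]
    [Finite G] [NeZero (Nat.card G : k)] (t : MonoidAlgebra k G)
    (h : ∀ (V : Type (max u v)) [AddCommGroup V] [Module k V] [FiniteDimensional k V]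
      (ρ : Representation k G V) [ρ.IsIrreducible], ρ.asAlgebraHom t = 0) : t = 0 := by
  have key : ∀ S : Submodule (MonoidAlgebra k G) (MonoidAlgebra k G),
      IsSimpleModule (MonoidAlgebra k G) S → ∀ m ∈ S, t * m = 0 := by
    intro S hS m hm
    have hfin : FiniteDimensional k S := Module.Finite.trans (MonoidAlgebra k G) _
    have hirr := Representation.isIrreducible_ofModule' (k := k) (G := G) (M := S)
    have h0 := LinearMap.congr_fun (h S (Representation.ofModule' S)) ⟨m, hm⟩
    rw [Representation.asAlgebraHom_ofModule'] at h0
    exact congrArg Subtype.val h0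
  have h1 : (1 : MonoidAlgebra k G) ∈ sSup {S : Submodule (MonoidAlgebra k G) (MonoidAlgebra k G) |
      IsSimpleModule (MonoidAlgebra k G) S} := by
    rw [IsSemisimpleModule.sSup_simples_eq_top]; trivial
  have h2 : t * 1 = 0 := by
    rw [sSup_eq_iSup'] at h1
    refine Submodule.iSup_induction _ (motive := fun m => t * m = 0) h1
      (fun S m hm => key S.1 S.2 m hm) (mul_zero t) fun a b ha hb => ?_
    rw [mul_add, ha, hb, add_zero]
  rwa [mul_one] at h2

/-- The irreducible complex representations separate the elements of a finite group. -/
theorem exists_irreducible_apply_ne_one {G : Type u} [Group G] [Finite G] {g : G} (hg : g ≠ 1) :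
    ∃ (V : Type u) (_ : AddCommGroup V) (_ : Module ℂ V) (_ : FiniteDimensional ℂ V)
      (ρ : Representation ℂ G V), ρ.IsIrreducible ∧ ρ g ≠ 1 := by
  by_contra! hall
  have : NeZero (Nat.card G : ℂ) := ⟨natCast_natCard_ne_zero_of_charZero ℂ⟩
  have h0 := MonoidAlgebra.eq_zero_of_forall_irreducible
    (MonoidAlgebra.of ℂ G g - 1) fun V _ _ hV ρ hρ => by
      rw [map_sub, Representation.asAlgebraHom_of, hall V _ _ hV ρ hρ, map_one, sub_self]
  rw [sub_eq_zero, ← map_one (MonoidAlgebra.of ℂ G)] at h0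
  exact hg (MonoidAlgebra.of_injective h0)

/-- The bilinear form `|G|⁻¹ ∑ a(g) b(g⁻¹)` on functions on a finite group. -/
noncomputable def classForm {G : Type*} [Group G] [Fintype G] (a b : G → ℂ) : ℂ :=
  (Nat.card G : ℂ)⁻¹ * ∑ g, a g * b g⁻¹

section classForm

variable {G : Type u} [Group G] [Fintype G]

theorem classForm_comm (a b : G → ℂ) : classForm a b = classForm b a := by
  rw [classForm, classForm]
  congr 1
  exact Fintype.sum_equiv (Equiv.inv G) _ _ fun g => by simp [mul_comm]

theorem classForm_add_left (a b c : G → ℂ) :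
    classForm (a + b) c = classForm a c + classForm b c := by
  simp [classForm, add_mul, Finset.sum_add_distrib, mul_add]

theorem classForm_sub_left (a b c : G → ℂ) :
    classForm (a - b) c = classForm a c - classForm b c := by
  simp [classForm, sub_mul, mul_sub]

theorem classForm_smul_left (r : ℂ) (a c : G → ℂ) :
    classForm (r • a) c = r * classForm a c := by
  simp only [classForm, Pi.smul_apply, smul_eq_mul, mul_assoc, ← Finset.mul_sum]
  ring

theorem classForm_one_one : classForm (1 : G → ℂ) 1 = 1 := by
  simp [classForm]

theorem classForm_self_eq {a : G → ℂ} (ha : ∀ g, a g⁻¹ = star (a g)) :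
    classForm a a = ((Nat.card G : ℝ)⁻¹ * ∑ g, Complex.normSq (a g) : ℝ) := by
  rw [classForm]
  push_cast
  congr 1
  refine Finset.sum_congr rfl fun g _ => ?_
  rw [ha, ← Complex.mul_conj]
  rfl

theorem classForm_character_eq_finrank {V W : Type*} [AddCommGroup V] [Module ℂ V]
    [FiniteDimensional ℂ V] [AddCommGroup W] [Module ℂ W] [FiniteDimensional ℂ W]
    (ρ : Representation ℂ G V) (σ : Representation ℂ G W) :
    classForm σ.character ρ.character = (Module.finrank ℂ (ρ.IntertwiningMap σ) : ℕ) := by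
  have : Invertible (Nat.card G : ℂ) := invertibleOfNonzero (natCast_natCard_ne_zero_of_charZero ℂ)
  exact Representation.card_inv_mul_sum_char_mul_char_eq_finrank ρ σ

theorem classForm_character_self {V : Type*} [AddCommGroup V] [Module ℂ V]
    [FiniteDimensional ℂ V] (ρ : Representation ℂ G V) [ρ.IsIrreducible] :
    classForm ρ.character ρ.character = 1 := by
  rw [classForm_character_eq_finrank, Representation.IsIrreducible.finrank_intertwiningMap_self,
    Nat.cast_one]

theorem character_trivial {G : Type*} [Group G] : (Representation.trivial ℂ G ℂ).character = 1 := by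
  ext g
  simp [Representation.character, Representation.trivial]

/-- A class function orthogonal to all irreducible characters is zero: by Schur's lemma
`∑ f(g) ρ(g⁻¹)` is a scalar on every irreducible representation, and its trace vanishes. -/
theorem eq_zero_of_classForm_irreducible_eq_zero {f : G → ℂ} (hf : ∀ g x, f (g * x * g⁻¹) = f x)
    (h : ∀ (V : Type u) [AddCommGroup V] [Module ℂ V] [FiniteDimensional ℂ V]
      (ρ : Representation ℂ G V) [ρ.IsIrreducible], classForm f ρ.character = 0) : f = 0 := by
  have hne : (Nat.card G : ℂ) ≠ 0 := natCast_natCard_ne_zero_of_charZero ℂ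
  have : NeZero (Nat.card G : ℂ) := ⟨hne⟩
  let t : MonoidAlgebra ℂ G := ∑ g, f g • MonoidAlgebra.of ℂ G g⁻¹
  have ht : t = 0 := by
    refine MonoidAlgebra.eq_zero_of_forall_irreducible t fun V _ _ _ ρ _ => ?_
    set T := ρ.asAlgebraHom t with hT
    have hTsum : T = ∑ g, f g • ρ g⁻¹ := by
      simp only [hT, t, map_sum, map_smul, Representation.asAlgebraHom_of]
    have hcomm : ∀ x, T * ρ x = ρ x * T := by
      intro x
      rw [hTsum, Finset.sum_mul, Finset.mul_sum]
      refine Fintype.sum_equiv (MulAut.conj x).symm.toEquiv _ _ fun g => ?_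
      have h1 : (MulAut.conj x).symm.toEquiv g = x⁻¹ * g * x := by simp
      rw [h1, smul_mul_assoc, mul_smul_comm, ← map_mul, ← map_mul]
      have h2 : f (x⁻¹ * g * x) = f g := by simpa using hf x⁻¹ g
      rw [h2]
      congr 2
      group
    obtain ⟨c, hc⟩ :=
      (Representation.IsIrreducible.algebraMap_intertwiningMap_bijective_of_isAlgClosed
        (ρ := ρ)).2 ⟨T, fun g => hcomm g⟩
    have hc' : T = c • 1 := by
      have := congrArg Representation.IntertwiningMap.toLinearMap hc
      rw [← Representation.IntertwiningMap.toLinearMap_mk ρ ρ T (fun g => hcomm g), ← this]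
      rfl
    have htr : LinearMap.trace ℂ V T = 0 := by
      have := h V ρ
      rw [classForm, mul_eq_zero, inv_eq_zero] at this
      rw [hTsum, map_sum, ← this.resolve_left hne]
      simp [Representation.character]
    have hnt : Nontrivial V := by
      have hS : IsSimpleModule (MonoidAlgebra ℂ G) ρ.asModule := inferInstance
      exact IsSimpleModule.nontrivial (MonoidAlgebra ℂ G) ρ.asModule
    rw [hc', map_smul, LinearMap.trace_one, smul_eq_mul, mul_eq_zero] at htr
    have hdim : (Module.finrank ℂ V : ℂ) ≠ 0 := by exact_mod_cast Module.finrank_pos.ne'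
    rw [hc', htr.resolve_right hdim, zero_smul]
  funext x
  have h1 := congrArg (fun y : MonoidAlgebra ℂ G => y.coeff x⁻¹) ht
  classical
  simpa [t, MonoidAlgebra.coeff_sum, MonoidAlgebra.of_apply, Finsupp.single_apply] using h1

end classForm
end

/-! ### Induced class functions -/

section

open Finset

variable {G : Type u} [Group G] [Fintype G] (H : Subgroup G)

open scoped Classical in
/-- The class function on `G` induced from a function `φ` on a subgroup `H`. -/
noncomputable def inducedFunction (φ : H → ℂ) (x : G) : ℂ :=
  (Nat.card H : ℂ)⁻¹ * ∑ g : G, if hx : g * x * g⁻¹ ∈ H then φ ⟨g * x * g⁻¹, hx⟩ else 0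

theorem inducedFunction_conj (φ : H → ℂ) (y x : G) :
    inducedFunction H φ (y * x * y⁻¹) = inducedFunction H φ x := by
  classical
  rw [inducedFunction, inducedFunction]
  congr 1
  refine Fintype.sum_equiv (Equiv.mulRight y) _ _ fun g => ?_
  have key : ∀ a b : G, a = b → (if hx : a ∈ H then φ ⟨a, hx⟩ else 0) =
      if hx : b ∈ H then φ ⟨b, hx⟩ else 0 := by rintro a _ rfl; rfl
  exact key _ _ (by rw [Equiv.coe_mulRight]; group)

theorem inducedFunction_eq_zero (φ : H → ℂ) {x : G} (hx : ∀ g, g * x * g⁻¹ ∉ H) :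
    inducedFunction H φ x = 0 := by
  simp [inducedFunction, hx]

/-- If `H` meets its other conjugates trivially, inducing a class function that vanishes at `1`
extends it. -/
theorem inducedFunction_of_isMalnormal (hH : H.IsMalnormal) {φ : H → ℂ}
    (hφ : ∀ g x : H, φ (g * x * g⁻¹) = φ x) (hφ1 : φ 1 = 0) (h : H) :
    inducedFunction H φ h = φ h := by
  classical
  have hne : (Nat.card H : ℂ) ≠ 0 := natCast_natCard_ne_zero_of_charZero ℂ
  have hterm : ∀ g : G, (if hx : g * (h : G) * g⁻¹ ∈ H then φ ⟨g * h * g⁻¹, hx⟩ else 0) =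
      if g ∈ H then φ h else 0 := by
    intro g
    by_cases hg : g ∈ H
    · have hx : g * (h : G) * g⁻¹ ∈ H := H.mul_mem (H.mul_mem hg h.2) (H.inv_mem hg)
      rw [dif_pos hx, if_pos hg]
      exact hφ ⟨g, hg⟩ h
    · rw [if_neg hg]
      split_ifs with hx
      · have h1 := hH g hg h h.2 hx
        have h2 : (⟨g * h * g⁻¹, hx⟩ : H) = 1 := by
          apply Subtype.ext
          simp [h1]
        rw [h2, hφ1]
      · rfl
  rw [inducedFunction, Finset.sum_congr rfl fun g _ => hterm g, ← Finset.sum_filter,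
    Finset.sum_const, nsmul_eq_mul]
  have hcard : (univ.filter fun g : G => g ∈ H).card = Nat.card H := by
    rw [Nat.card_eq_fintype_card, Fintype.card_subtype]
  rw [hcard, inv_mul_cancel_left₀ hne]

theorem inducedFunction_inv {φ : H → ℂ} (hφ : ∀ h, φ h⁻¹ = star (φ h)) (x : G) :
    inducedFunction H φ x⁻¹ = star (inducedFunction H φ x) := by
  classical
  rw [inducedFunction, inducedFunction, star_mul', star_sum]
  congr 1
  · simp
  · refine Finset.sum_congr rfl fun g _ => ?_
    have h1 : g * x⁻¹ * g⁻¹ = (g * x * g⁻¹)⁻¹ := by group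
    by_cases hx : g * x * g⁻¹ ∈ H
    · have hx' : g * x⁻¹ * g⁻¹ ∈ H := h1 ▸ H.inv_mem hx
      rw [dif_pos hx, dif_pos hx', ← hφ]
      congr 1
      exact Subtype.ext h1
    · have hx' : g * x⁻¹ * g⁻¹ ∉ H := by rwa [h1, inv_mem_iff]
      rw [dif_neg hx, dif_neg hx', star_zero]

/-- Frobenius reciprocity. -/
theorem classForm_inducedFunction [Fintype H] (φ : H → ℂ) {s : G → ℂ}
    (hs : ∀ g x, s (g * x * g⁻¹) = s x) :
    classForm (inducedFunction H φ) s = classForm φ (fun h : H => s h) := by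
  classical
  have hne : (Nat.card G : ℂ) ≠ 0 := natCast_natCard_ne_zero_of_charZero ℂ
  let F : G → ℂ := fun y => if hy : y ∈ H then φ ⟨y, hy⟩ * s y⁻¹ else 0
  have h1 : ∀ x, inducedFunction H φ x * s x⁻¹ =
      (Nat.card H : ℂ)⁻¹ * ∑ g : G, F (g * x * g⁻¹) := by
    intro x
    rw [inducedFunction, mul_assoc, Finset.sum_mul]
    congr 1
    refine Finset.sum_congr rfl fun g _ => ?_
    have h2 : s (g * x * g⁻¹)⁻¹ = s x⁻¹ := by
      rw [← hs g x⁻¹]; congr 1; group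
    simp only [F, h2]
    split_ifs
    · rfl
    · rw [zero_mul]
  have h3 : ∑ h : H, φ h * s (h : G)⁻¹ = ∑ y : G, F y := by
    rw [← Finset.sum_subset (Finset.subset_univ (univ.filter fun y : G => y ∈ H))]
    · rw [Finset.sum_subtype (p := fun y => y ∈ H) _ (by simp)]
      refine Finset.sum_congr (by congr) fun h _ => ?_
      simp [F]
    · intro y _ hy
      simp only [mem_filter, mem_univ, true_and] at hy
      simp [F, hy]
  have h4 : ∀ g : G, ∑ x : G, F (g * x * g⁻¹) = ∑ y : G, F y := fun g =>
    Fintype.sum_equiv (MulAut.conj g).toEquiv _ _ fun x => by simp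
  rw [classForm, classForm]
  simp only [h1]
  rw [← Finset.mul_sum, Finset.sum_comm]
  simp only [h4, Finset.sum_const, nsmul_eq_mul]
  have h5 : ((univ : Finset G).card : ℂ) = Nat.card G := by
    rw [Finset.card_univ, Nat.card_eq_fintype_card]
  rw [h5, mul_left_comm, inv_mul_cancel_left₀ hne]
  congr 1
  exact h3.symm

end

/-! ### Frobenius's theorem -/

section

open Finset

variable {G : Type u} [Group G]

/-- A class function of norm `1` whose products with irreducible characters are integers, and whose
value at `1` is positive, is the character of an irreducible representation: some
product `k` with an irreducible character `χ` is nonzero, and `f - k χ` has norm `1 - k ^ 2 ≥ 0`. -/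
theorem exists_representation_character_eq [Fintype G] {f : G → ℂ}
    (hf : ∀ g x, f (g * x * g⁻¹) = f x) (hinv : ∀ g, f g⁻¹ = star (f g))
    (hnorm : classForm f f = 1) {d : ℕ} (hd : 0 < d) (hf1 : f 1 = d)
    (hint : ∀ (V : Type u) [AddCommGroup V] [Module ℂ V] [FiniteDimensional ℂ V]
      (ρ : Representation ℂ G V), ∃ k : ℤ, classForm f ρ.character = k) :
    ∃ (V : Type u) (_ : AddCommGroup V) (_ : Module ℂ V) (_ : FiniteDimensional ℂ V)
      (ρ : Representation ℂ G V), ρ.character = f := by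
  have hf0 : f ≠ 0 := by
    rintro rfl
    simp [classForm] at hnorm
  obtain ⟨V, _, _, _, ρ, hρ, hne⟩ : ∃ (V : Type u) (_ : AddCommGroup V) (_ : Module ℂ V)
      (_ : FiniteDimensional ℂ V) (ρ : Representation ℂ G V),
      ρ.IsIrreducible ∧ classForm f ρ.character ≠ 0 := by
    by_contra! hall
    exact hf0 (eq_zero_of_classForm_irreducible_eq_zero hf fun V _ _ hV ρ hρ =>
      hall V _ _ hV ρ hρ)
  obtain ⟨k, hk⟩ := hint V ρ
  have hk0 : k ≠ 0 := by
    rintro rfl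
    exact hne (by simpa using hk)
  refine ⟨V, _, _, ‹_›, ρ, ?_⟩
  -- `D` has norm `1 - k ^ 2 ≤ 0`, while its norm is a sum of squares
  set D : G → ℂ := f - (k : ℂ) • ρ.character with hD
  have hDinv : ∀ g, D g⁻¹ = star (D g) := by
    intro g
    simp only [hD, Pi.sub_apply, Pi.smul_apply, smul_eq_mul, hinv, ρ.character_inv, star_sub,
      star_mul']
    simp
  have hDD : classForm D D = 1 - (k : ℂ) ^ 2 := by
    rw [hD, classForm_sub_left, classForm_smul_left, classForm_comm f, classForm_comm ρ.character,
      classForm_sub_left, classForm_sub_left, classForm_smul_left, classForm_smul_left,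
      classForm_character_self, classForm_comm ρ.character, hk, hnorm]
    ring
  rw [classForm_self_eq hDinv] at hDD
  have hDD' : (Nat.card G : ℝ)⁻¹ * ∑ g, Complex.normSq (D g) = 1 - (k : ℝ) ^ 2 := by
    exact_mod_cast hDD
  have hnonneg : ∀ g ∈ univ, 0 ≤ Complex.normSq (D g) := fun g _ => Complex.normSq_nonneg _
  have hksq : (1 : ℝ) ≤ (k : ℝ) ^ 2 := by
    have : 1 ≤ k ^ 2 := by have := sq_pos_of_ne_zero hk0; omega
    exact_mod_cast this
  have hcard : (0 : ℝ) < (Nat.card G : ℝ)⁻¹ := by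
    have : 0 < Nat.card G := Nat.card_pos
    positivity
  have hsum : ∑ g, Complex.normSq (D g) = 0 := by
    refine le_antisymm ?_ (Finset.sum_nonneg hnonneg)
    by_contra! hpos
    have := mul_pos hcard hpos
    linarith
  have hD0 : ∀ g, f g = k * ρ.character g := by
    intro g
    have h1 := (Finset.sum_eq_zero_iff_of_nonneg hnonneg).mp hsum g (mem_univ g)
    rw [Complex.normSq_eq_zero] at h1
    simpa [hD, sub_eq_zero] using h1
  have hk1 : k = 1 := by
    have h1 := hD0 1
    rw [hf1, ρ.char_one] at h1
    have h2 : (d : ℤ) = k * Module.finrank ℂ V := by exact_mod_cast h1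
    have h3 : 0 < k := by
      by_contra! h
      have := mul_nonpos_of_nonpos_of_nonneg h (Int.natCast_nonneg (Module.finrank ℂ V))
      omega
    rw [hsum, mul_zero] at hDD'
    have h4 : k ^ 2 = 1 := by
      have : (k : ℝ) ^ 2 = 1 := by linarith
      exact_mod_cast this
    nlinarith
  funext g
  rw [hD0 g, hk1]
  simp

/-- Every irreducible character `χ` of a malnormal subgroup `H` extends to a character of `G` that
is constant outside the conjugates of `H`, namely `Ind (χ - χ(1)) + χ(1)`. -/
theorem exists_character_extension [Finite G] {H : Subgroup G} (hH : H.IsMalnormal) {W : Type*}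
    [AddCommGroup W] [Module ℂ W] [FiniteDimensional ℂ W] (σ : Representation ℂ H W)
    [σ.IsIrreducible] :
    ∃ (V : Type u) (_ : AddCommGroup V) (_ : Module ℂ V) (_ : FiniteDimensional ℂ V)
      (ρ : Representation ℂ G V), (∀ h : H, ρ.character h = σ.character h) ∧
        ∀ x : G, (∀ g, g * x * g⁻¹ ∉ H) → ρ.character x = Module.finrank ℂ W := by
  have := Fintype.ofFinite G
  have := Fintype.ofFinite H
  set d := Module.finrank ℂ W with hd
  have hnt : Nontrivial W := by
    have hS : IsSimpleModule (MonoidAlgebra ℂ H) σ.asModule := inferInstance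
    exact IsSimpleModule.nontrivial (MonoidAlgebra ℂ H) σ.asModule
  set φ : H → ℂ := σ.character - (d : ℂ) • 1 with hφ
  have hφinv : ∀ h, φ h⁻¹ = star (φ h) := by
    intro h
    simp [hφ, σ.character_inv]
  have hφ1 : φ 1 = 0 := by simp [hφ, hd]
  set f : G → ℂ := inducedFunction H φ + (d : ℂ) • 1 with hf
  have hfH : ∀ h : H, f h = σ.character h := by
    intro h
    rw [hf, Pi.add_apply, inducedFunction_of_isMalnormal H hH (fun g x => by simp [hφ]) hφ1]
    simp [hφ]
  have hfout : ∀ x : G, (∀ g, g * x * g⁻¹ ∉ H) → f x = d := by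
    intro x hx
    simp [hf, inducedFunction_eq_zero H φ hx]
  have hfconj : ∀ g x, f (g * x * g⁻¹) = f x := by
    intro g x
    simp [hf, inducedFunction_conj]
  have hform : ∀ s : G → ℂ, (∀ g x, s (g * x * g⁻¹) = s x) → classForm f s =
      classForm σ.character (fun h : H => s h) - d * classForm 1 (fun h : H => s h) +
        d * classForm 1 s := by
    intro s hs
    rw [hf, classForm_add_left, classForm_smul_left, classForm_inducedFunction H φ hs, hφ,
      classForm_sub_left, classForm_smul_left]
  have hnorm : classForm f f = 1 := by
    have h1 : (fun h : H => f h) = σ.character := funext hfH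
    have h2 : classForm 1 f = classForm (1 : H → ℂ) σ.character := by
      rw [classForm_comm, hform 1 fun _ _ => rfl, classForm_comm 1 σ.character]
      have : (fun h : H => (1 : G → ℂ) h) = 1 := rfl
      rw [this, classForm_one_one, classForm_one_one]
      ring
    rw [hform f hfconj, h1, h2, classForm_character_self]
    ring
  have hfinv : ∀ g, f g⁻¹ = star (f g) := by
    intro g
    simp [hf, inducedFunction_inv H hφinv]
  have hf1 : f 1 = d := by rw [← H.coe_one, hfH, σ.char_one]
  have hint : ∀ (V : Type u) [AddCommGroup V] [Module ℂ V] [FiniteDimensional ℂ V]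
      (ρ : Representation ℂ G V), ∃ k : ℤ, classForm f ρ.character = k := by
    intro V _ _ _ ρ
    have hres : (fun h : H => ρ.character h) =
        Representation.character (ρ.comp H.subtype : Representation ℂ H V) := rfl
    rw [hform _ fun g x => ρ.char_conj x g, hres, ← character_trivial, ← character_trivial,
      classForm_character_eq_finrank, classForm_character_eq_finrank,
      classForm_character_eq_finrank]
    exact ⟨_ - d * _ + d * _, by push_cast; rfl⟩
  obtain ⟨V, _, _, hV, ρ, hρ⟩ := exists_representation_character_eq hfconj hfinv hnorm
    Module.finrank_pos hf1 hint
  exact ⟨V, _, _, hV, ρ, by rw [hρ]; exact hfH, by rw [hρ]; exact hfout⟩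

/-- Frobenius's theorem: there is a normal subgroup that meets `H` trivially and contains all
elements outside the conjugates of `H`. It is the intersection of the kernels of representations
of `G` extending the irreducible characters of `H`. -/
theorem Subgroup.IsMalnormal.exists_normal [Finite G] {H : Subgroup G} (hH : H.IsMalnormal) :
    ∃ N : Subgroup G, N.Normal ∧ (∀ h ∈ H, h ∈ N → h = 1) ∧
      ∀ x : G, (∀ g, g * x * g⁻¹ ∉ H) → x ∈ N := by
  have hex : ∀ h : {h : H // h ≠ 1}, ∃ N : Subgroup G, N.Normal ∧ (h : G) ∉ N ∧
      ∀ x : G, (∀ g, g * x * g⁻¹ ∉ H) → x ∈ N := by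
    rintro ⟨h, hh⟩
    obtain ⟨W, _, _, _, σ, hσ, hne⟩ := exists_irreducible_apply_ne_one hh
    obtain ⟨V, _, _, _, ρ, hρH, hρ⟩ := exists_character_extension hH σ
    have hdim : (Module.finrank ℂ V : ℂ) = Module.finrank ℂ W := by
      rw [← ρ.char_one, ← σ.char_one, ← hρH, H.coe_one]
    refine ⟨MonoidHom.ker ρ, inferInstance, fun hmem => hne ?_, fun x hx => ?_⟩
    · apply σ.eq_one_of_character_eq_finrank
      rw [MonoidHom.mem_ker] at hmem
      rw [← hρH, Representation.character, hmem, LinearMap.trace_one, hdim]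
    · rw [MonoidHom.mem_ker]
      apply ρ.eq_one_of_character_eq_finrank
      rw [hρ x hx, hdim]
  choose N hN hNh hNx using hex
  refine ⟨⨅ h, N h, Subgroup.normal_iInf_normal hN, fun h hh hmem => ?_, fun x hx => ?_⟩
  · by_contra h1
    have hne : (⟨h, hh⟩ : H) ≠ 1 := by simpa using h1
    exact hNh ⟨_, hne⟩ (Subgroup.mem_iInf.mp hmem ⟨_, hne⟩)
  · exact Subgroup.mem_iInf.mpr fun h => hNx h x hx

end

/-! ### Conjugation action on a `p`-subgroup -/

section

open Finset

/-- The elements of exponent dividing `p` in the center of `P`. -/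
def Subgroup.centerTorsion {G : Type*} [Group G] (P : Subgroup G) (p : ℕ) : Subgroup G where
  carrier := {x | x ∈ P ∧ (∀ y ∈ P, y * x = x * y) ∧ x ^ p = 1}
  one_mem' := ⟨P.one_mem, by simp, one_pow _⟩
  mul_mem' := by
    rintro a b ⟨ha, hac, hap⟩ ⟨hb, hbc, hbp⟩
    refine ⟨P.mul_mem ha hb, fun y hy => ?_, ?_⟩
    · rw [← mul_assoc, hac y hy, mul_assoc, hbc y hy, mul_assoc]
    · rw [Commute.mul_pow (hbc a ha), hap, hbp, one_mul]
  inv_mem' := by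
    rintro a ⟨ha, hac, hap⟩
    refine ⟨P.inv_mem ha, fun y hy => ?_, by rw [inv_pow, hap, inv_one]⟩
    exact (Commute.inv_right (hac y hy) : Commute y a⁻¹)

theorem Subgroup.conj_mem_centerTorsion {G : Type*} [Group G] {P : Subgroup G} {p : ℕ} {g : G}
    (hg : ∀ x, x ∈ P ↔ g * x * g⁻¹ ∈ P) {a : G} (ha : a ∈ P.centerTorsion p) :
    g * a * g⁻¹ ∈ P.centerTorsion p := by
  obtain ⟨haP, hac, hap⟩ := ha
  refine ⟨(hg a).mp haP, fun y hy => ?_, by rw [conj_pow, hap]; simp⟩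
  have h1 : g⁻¹ * y * g ∈ P := by
    rw [hg]
    convert hy using 1
    group
  have h2 := hac _ h1
  calc y * (g * a * g⁻¹) = g * ((g⁻¹ * y * g) * a) * g⁻¹ := by group
    _ = _ := by rw [h2]; group

theorem Subgroup.exists_ne_one_mem_centerTorsion {G : Type*} [Group G] [Finite G] {P : Subgroup G}
    {p : ℕ} [Fact p.Prime] (hP : IsPGroup p P) (hne : P ≠ ⊥) :
    ∃ a ∈ P.centerTorsion p, a ≠ 1 := by
  have hnt : Nontrivial P := (Subgroup.nontrivial_iff_ne_bot P).mpr hne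
  have hcnt : Nontrivial (Subgroup.center P) := hP.center_nontrivial
  have hC : IsPGroup p (Subgroup.center P) := hP.to_subgroup _
  obtain ⟨n, hn0, hn⟩ := hC.nontrivial_iff_card.mp hcnt
  obtain ⟨z, hz⟩ := exists_prime_orderOf_dvd_card' (G := Subgroup.center P) p
    (hn ▸ dvd_pow_self p hn0.ne')
  refine ⟨((z : P) : G), ⟨z.1.2, fun y hy => ?_, ?_⟩, fun h1 => ?_⟩
  · exact congrArg Subtype.val (Subgroup.mem_center_iff.mp z.2 ⟨y, hy⟩)
  · have := pow_orderOf_eq_one z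
    rw [hz] at this
    exact congrArg (fun w : Subgroup.center P => ((w : P) : G)) this
  · have : z = 1 := Subtype.ext (Subtype.ext h1)
    rw [this, orderOf_one] at hz
    exact (Fact.out : p.Prime).one_lt.ne hz

/-- An action by automorphisms on a group of exponent `p` is a representation over `ZMod p`. -/
theorem cosetSumZero_zmod_ne_bot_of_mulAut {K A : Type*} [Group K] [CommGroup A] [Nontrivial A]
    {p : ℕ} [Fact p.Prime] (htor : ∀ a : A, a ^ p = 1) (α : K →* MulAut A)
    (hfree : ∀ (k : K) (a : A), a ≠ 1 → α k a = a → k = 1) : cosetSumZero K (ZMod p) ≠ ⊥ := by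
  let _ : Module (ZMod p) (Additive A) := AddCommGroup.zmodModule (n := p) fun x => htor x.toMul
  let ρ : Representation (ZMod p) K (Additive A) :=
    { toFun := fun k => (MonoidHom.toAdditive (α k).toMonoidHom).toZModLinearMap p
      map_one' := by
        apply LinearMap.ext
        intro a
        change Additive.ofMul (α 1 a.toMul) = a
        rw [map_one]
        rfl
      map_mul' := fun k l => by
        apply LinearMap.ext
        intro a
        change Additive.ofMul (α (k * l) a.toMul) = Additive.ofMul (α k (α l a.toMul))
        rw [map_mul]
        rfl }
  exact cosetSumZero_ne_bot_of_fixedPointFree ρ fun k x hx hfix => hfree k x.toMul hx hfix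

/-- A group acting by conjugation on a nontrivial `p`-subgroup so that nontrivial elements commute
with no nontrivial element of it has a nonzero function with vanishing coset sums modulo `p`: it
acts without fixed points on the elements of order `p` in the center. -/
theorem cosetSumZero_zmod_ne_bot_of_conj {G : Type*} [Group G] [Finite G] {K : Type*} [Group K]
    (f : K →* G) {P : Subgroup G} {p : ℕ} [Fact p.Prime] (hP : IsPGroup p P) (hne : P ≠ ⊥)
    (hnorm : ∀ k x, x ∈ P ↔ f k * x * (f k)⁻¹ ∈ P)
    (hfree : ∀ k, ∀ x ∈ P, f k * x * (f k)⁻¹ = x → x ≠ 1 → k = 1) :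
    cosetSumZero K (ZMod p) ≠ ⊥ := by
  let _ : CommGroup (P.centerTorsion p) :=
    { (inferInstance : Group (P.centerTorsion p)) with
      mul_comm := fun a b => Subtype.ext (b.2.2.1 a a.2.1) }
  have hmem : ∀ k, ∀ a ∈ P.centerTorsion p, f k * a * (f k)⁻¹ ∈ P.centerTorsion p :=
    fun k a ha => Subgroup.conj_mem_centerTorsion (hnorm k) ha
  let α : K →* MulAut (P.centerTorsion p) :=
    { toFun := fun k =>
        { toFun := fun a => ⟨f k * a * (f k)⁻¹, hmem k a a.2⟩
          invFun := fun a => ⟨f k⁻¹ * a * (f k⁻¹)⁻¹, hmem k⁻¹ a a.2⟩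
          left_inv := fun a => Subtype.ext (by simp [mul_assoc])
          right_inv := fun a => Subtype.ext (by simp [mul_assoc])
          map_mul' := fun a b => Subtype.ext (by simp) }
      map_one' := by
        ext a
        simp
      map_mul' := fun k l => by
        ext a
        simp [mul_assoc] }
  obtain ⟨a, ha, ha1⟩ := Subgroup.exists_ne_one_mem_centerTorsion hP hne
  have : Nontrivial (P.centerTorsion p) :=
    ⟨⟨a, ha⟩, 1, fun h => ha1 (congrArg Subtype.val h)⟩
  refine cosetSumZero_zmod_ne_bot_of_mulAut (fun a => Subtype.ext a.2.2.2) α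
    fun k x hx hfix => hfree k x x.2.1 (congrArg Subtype.val hfix) fun h1 => hx (Subtype.ext h1)

end

/-! ### From a Frobenius pair to a fixed-point-free representation -/

section

open Finset

theorem Subgroup.IsMalnormal.eq_one_of_commute {G : Type*} [Group G] {H N : Subgroup G}
    (hH : H.IsMalnormal)
    (hdisj : Disjoint H N) {h x : G} (hh : h ∈ H) (h1 : h ≠ 1) (hx : x ∈ N)
    (hcomm : h * x * h⁻¹ = x) : x = 1 := by
  by_contra hx1
  have hxH : x ∉ H := fun hxH => hx1 (Subgroup.disjoint_def.mp hdisj hxH hx)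
  apply h1
  refine hH x hxH h hh ?_
  have h2 : x * h = h * x := by
    conv_lhs => rw [← hcomm]
    group
  rw [h2, mul_inv_cancel_right]
  exact hh

variable {G : Type u} [Group G] [Finite G]

/-- The Frobenius kernel: a normal complement of a malnormal subgroup, outside of which lie only
elements conjugate into the subgroup. -/
theorem Subgroup.IsMalnormal.exists_normal_complement {H : Subgroup G} (hH : H.IsMalnormal) :
    ∃ N : Subgroup G, N.Normal ∧ H.IsComplement' N ∧ ∀ x ∉ N, ∃ g, g * x * g⁻¹ ∈ H := by
  obtain ⟨N, hN, hNH, hNx⟩ := hH.exists_normal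
  refine ⟨N, hN, ?_, fun x hx => by by_contra! h; exact hx (hNx x h)⟩
  have hcompl : (N : Set G) = (Set.range (conjOut H))ᶜ := by
    ext x
    rw [Set.mem_compl_iff, SetLike.mem_coe]
    constructor
    · rintro hx ⟨⟨q, h⟩, rfl⟩
      apply h.2
      apply Subtype.ext
      refine hNH h.1 h.1.2 ?_
      have := hN.conj_mem _ hx q.out⁻¹
      simpa [conjOut, mul_assoc] using this
    · intro hx
      by_cases hx1 : x = 1
      · rw [hx1]; exact N.one_mem
      refine hNx x fun g hg => hx ?_
      rw [range_conjOut]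
      refine ⟨Set.mem_iUnion.mpr ⟨g⁻¹, g * x * g⁻¹, hg, by group⟩, hx1⟩
  have hcard : Nat.card N + H.index * (Nat.card H - 1) = Nat.card G := by
    rw [← natCard_conjOut_domain, ← Nat.card_range_of_injective ((conjOut_injective_iff H).mpr hH),
      add_comm, ← Set.ncard_add_ncard_compl (Set.range (conjOut H)), ← hcompl]
    rfl
  refine Subgroup.isComplement'_of_card_mul_and_disjoint ?_ ?_
  · rw [← H.card_mul_index] at hcard ⊢
    congr 1
    obtain ⟨m, hm⟩ : ∃ m, Nat.card H = m + 1 := ⟨Nat.card H - 1, by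
      have : 0 < Nat.card H := Nat.card_pos
      omega⟩
    rw [hm, Nat.add_sub_cancel] at hcard
    linarith
  · rw [Subgroup.disjoint_def]
    exact fun {x} hx hx' => hNH x hx hx'

/-- If a prime `p` divided both orders, an element of order `p` of `H` would fix a nontrivial
element of `N` under conjugation. -/
theorem Subgroup.IsMalnormal.coprime {H N : Subgroup G} (hH : H.IsMalnormal) [N.Normal]
    (hdisj : Disjoint H N) : Nat.Coprime (Nat.card N) (Nat.card H) := by
  by_contra hcop
  obtain ⟨p, hp, hpN, hpH⟩ := Nat.Prime.not_coprime_iff_dvd.mp hcop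
  have : Fact p.Prime := ⟨hp⟩
  obtain ⟨h, hh⟩ := exists_prime_orderOf_dvd_card' p hpH
  have hP : IsPGroup p (Subgroup.zpowers (h : G)) := by
    refine IsPGroup.of_card (n := 1) ?_
    rw [Nat.card_zpowers, Subgroup.orderOf_coe, hh, pow_one]
  let _ : MulAction (Subgroup.zpowers (h : G)) N :=
    MulAction.compHom N ((MulAut.conjNormal (H := N)).comp (Subgroup.zpowers (h : G)).subtype)
  have hsmul : ∀ (z : Subgroup.zpowers (h : G)) (n : N), ((z • n : N) : G) = z * n * (z : G)⁻¹ :=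
    fun z n => MulAut.conjNormal_apply _ _
  obtain ⟨n, hn, hn1⟩ := hP.exists_fixed_point_of_prime_dvd_card_of_fixed_point N hpN (a := 1)
    (fun z => Subtype.ext (by rw [hsmul]; simp))
  apply hn1
  have h1 := congrArg Subtype.val (hn ⟨h, Subgroup.mem_zpowers _⟩)
  rw [hsmul] at h1
  refine (Subtype.ext (hH.eq_one_of_commute hdisj h.2 ?_ n.2 h1)).symm
  intro h2
  rw [← Subgroup.orderOf_coe, h2, orderOf_one] at hh
  exact hp.one_lt.ne hh

/-- By Frattini's argument and the Schur–Zassenhaus theorem, the kernel has a complement that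
normalizes a given Sylow subgroup of the kernel. -/
theorem Subgroup.exists_complement_normalizing_sylow {N : Subgroup G} [N.Normal]
    (hcop : Nat.Coprime (Nat.card N) N.index) {p : ℕ} [Fact p.Prime] (P : Sylow p N) :
    ∃ K : Subgroup G, K.IsComplement' N ∧
      ∀ k ∈ K, ∀ x, x ∈ (P : Subgroup N).map N.subtype ↔
        k * x * k⁻¹ ∈ (P : Subgroup N).map N.subtype := by
  set T : Subgroup G := Subgroup.normalizer ((P : Subgroup N).map N.subtype) with hT
  have hsup : T ⊔ N = ⊤ := P.normalizer_sup_eq_top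
  have hindex : (N.subgroupOf T).index = N.index := by
    change N.relIndex T = N.index
    rw [← Subgroup.relIndex_sup_right, hsup, Subgroup.relIndex_top_right]
  have hdvd : Nat.card (N.subgroupOf T) ∣ Nat.card N :=
    Subgroup.card_comap_dvd_of_injective N T.subtype T.subtype_injective
  obtain ⟨K, hK⟩ := Subgroup.exists_right_complement'_of_coprime (N := N.subgroupOf T)
    (by rw [hindex]; exact hcop.coprime_dvd_left hdvd)
  refine ⟨K.map T.subtype, ?_, ?_⟩
  · refine Subgroup.isComplement'_of_card_mul_and_disjoint ?_ ?_
    · rw [Subgroup.card_map_of_injective T.subtype_injective, ← hK.symm.index_eq_card, hindex,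
        mul_comm, N.card_mul_index]
    · rw [Subgroup.disjoint_def]
      rintro _ ⟨k, hk, rfl⟩ hkN
      have : k = 1 := Subgroup.disjoint_def.mp hK.disjoint (Subgroup.mem_subgroupOf.mpr hkN) hk
      simp [this]
  · rintro _ ⟨k, -, rfl⟩ x
    exact Subgroup.mem_normalizer_iff.mp k.2 x

theorem cosetSumZero_ne_bot_of_isFrobeniusComplement {H : Type u} [Group H] [Finite H]
    [Nontrivial H] (h : IsFrobeniusComplement.{u, v} H) : cosetSumZero H ℚ ≠ ⊥ := by
  obtain ⟨G, _, L, ⟨e⟩, hpair⟩ := h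
  obtain ⟨_, -, htop, hmal⟩ := (isFrobeniusPair_iff L).mp hpair
  obtain ⟨N, hN, hLN, hout⟩ := hmal.exists_normal_complement
  have hcop := hmal.coprime hLN.disjoint
  have hindex : N.index = Nat.card L := hLN.index_eq_card
  have hNcard : Nat.card N ≠ 1 := by
    intro h1
    apply htop
    rw [← Subgroup.card_eq_iff_eq_top, ← hLN.card_mul_card, h1, mul_one]
  obtain ⟨p, hp, hpN⟩ := Nat.exists_prime_and_dvd hNcard
  have : Fact p.Prime := ⟨hp⟩
  obtain ⟨P⟩ : Nonempty (Sylow p N) := inferInstance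
  obtain ⟨K, hKN, hKP⟩ := Subgroup.exists_complement_normalizing_sylow (hindex ▸ hcop) P
  let f : H ≃* K := e.trans (hLN.QuotientMulEquiv.symm.trans hKN.QuotientMulEquiv)
  have hcard : (Nat.card H : ZMod p) ≠ 0 := by
    rw [Ne, ZMod.natCast_eq_zero_iff, Nat.card_congr e.toEquiv]
    intro hpL
    exact hp.one_lt.ne' (Nat.dvd_one.mp (hcop ▸ Nat.dvd_gcd hpN hpL))
  rw [← cosetSumZero_ne_bot_iff_rat hcard]
  have hPp : IsPGroup p ((P : Subgroup N).map N.subtype) := P.isPGroup'.map N.subtype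
  refine cosetSumZero_zmod_ne_bot_of_conj (K.subtype.comp f.toMonoidHom)
    (P := (P : Subgroup N).map N.subtype) hPp ?_ (fun k x => hKP _ (f k).2 x) ?_
  · rw [Ne, Subgroup.map_eq_bot_iff_of_injective _ N.subtype_injective]
    exact P.ne_bot_of_dvd_card hpN
  · intro k x hx hfix hx1
    by_contra hk
    have hkN : ((f k : K) : G) ∉ N := by
      intro hmem
      have h1 := Subgroup.disjoint_def.mp hKN.disjoint (f k).2 hmem
      exact hk (f.injective (by rw [map_one]; exact Subtype.ext h1))
    -- a nontrivial element of the new complement is conjugate to one of the original complement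
    obtain ⟨g, hg⟩ := hout _ hkN
    have hxN : x ∈ N := Subgroup.map_subtype_le _ hx
    have h2 : g * x * g⁻¹ = 1 := by
      refine hmal.eq_one_of_commute hLN.disjoint hg ?_ (hN.conj_mem _ hxN g) ?_
      · intro h3
        rw [conj_eq_one_iff] at h3
        exact hkN (h3 ▸ N.one_mem)
      · have h4 : (f k : G) * x * (f k : G)⁻¹ = x := hfix
        conv_rhs => rw [← h4]
        group
    exact hx1 (by rwa [conj_eq_one_iff] at h2)

end

theorem mainTheorem10 (H : Type u) [Group H] [Finite H] [Nontrivial H] :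
    List.TFAE [
      IsFrobeniusComplement.{u, v} H,
      ∃ (K : Type w) (_ : Field K), HasFixedPointFreeRep H K,
      ∀ (K : Type x) [Field K], ¬ ringChar K ∣ Nat.card H → HasFixedPointFreeRep H K,
      ActsLinearlyFreelyOnSphere H] := by
  have h1 : IsFrobeniusComplement.{u, v} H ↔ cosetSumZero H ℚ ≠ ⊥ :=
    ⟨cosetSumZero_ne_bot_of_isFrobeniusComplement, isFrobeniusComplement_of_cosetSumZero⟩
  rw [h1, exists_hasFixedPointFreeRep_iff, forall_hasFixedPointFreeRep_iff,
    actsLinearlyFreelyOnSphere_iff]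
  exact List.tfae_of_forall (cosetSumZero H ℚ ≠ ⊥) _ (by simp)
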